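/- Let $p$ be an odd prime, and let $T$ be the $p$-regular rooted tree, whose vertices are the finite words over the alphabet $\{1,\dots,p\}$, with root the empty word and with the children of a word $w$ being the words $wx$, $x\in\{1,\dots,p\}$. Let $\mathbf e=(e_0,\dots,e_{p-2})\in(\mathbf F_p)^{p-1}\setminus\{0\}$. Let $a$ be the automorphism of $T$ given by $a(xw)=\varepsilon(x)w$ for every letter $x$ and every word $w$, where $\varepsilon$ is the cyclic permutation $(1\,2\,\dots\,p)$, and let $b$ be the automorphism of $T$ defined recursively by $b=(a^{e_0},\dots,a^{e_{p-2}},b)$, that is, $b(xw)=x\,a^{e_{x-1}}(w)$ for $1\le x\le p-1$ and $b(pw)=p\,b(w)$ for every word $w$ (both fix the root). Let $G_{\mathbf e}=\langle a,b\rangle\le\mathrm{Aut}(T)$ be the GGS group with defining vector $\mathbf e$. If $G_{\mathbf e}$ is a torsion group (every element has finite order), then $G_{\mathbf e}$ is subgroup separable (LERF): every finitely generated subgroup of $G_{\mathbf e}$ is closed in the profinite topology of $G_{\mathbf e}$, i.e. the topology generated by the cosets of the subgroups of finite index. -/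

import Mathlib

namespace GGS

open scoped Pointwise Topology

/-- Automorphisms of the regular rooted tree whose vertices are the finite words over `X`.
The prefix relation is the tree order (the root, the empty word, is its least element), and
the order automorphisms are exactly the automorphisms of the rooted tree. Multiplication is
composition, and the group acts on words from the left. -/
abbrev TreeAut (X : Type*) : Type _ :=
  (List.IsPrefix : List X → List X → Prop) ≃r (List.IsPrefix : List X → List X → Prop)

/-- `x₁ x₂ … xₙ ↦ (x₁ + k) x₂ … xₙ`, the root fixed. -/
def rotFun {p : ℕ} (k : ZMod p) : List (ZMod p) → List (ZMod p)
  | [] => []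
  | x :: w => (x + k) :: w

/-- The rooted automorphism `a = ε · (1, …, 1)`, which permutes the first letter by the cyclic
permutation `ε` and does not change the other letters. The letters `1, …, p` of the
alphabet are represented by the residues `0, …, p - 1`, so that `ε` is `x ↦ x + 1`. -/
def a (p : ℕ) : TreeAut (ZMod p) where
  toFun := rotFun 1
  invFun := rotFun (-1)
  left_inv w := by cases w <;> simp [rotFun]
  right_inv w := by cases w <;> simp [rotFun]
  map_rel_iff' {u v} := by
    cases u <;> cases v <;> simp [rotFun, List.cons_prefix_cons]

/-- The map `f` with `f ∅ = ∅`, `f (i w) = i (sᵢ w)` for the letters `i = 0, …, p - 2`, and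
`f ((p - 1) w) = (p - 1) (f w)`. -/
def spineFun {p : ℕ} (s : Fin (p - 1) → TreeAut (ZMod p)) : List (ZMod p) → List (ZMod p)
  | [] => []
  | x :: w => x :: (if h : x.val < p - 1 then s ⟨x.val, h⟩ w else spineFun s w)

theorem spineFun_inv_spineFun {p : ℕ} (s : Fin (p - 1) → TreeAut (ZMod p))
    (w : List (ZMod p)) : spineFun s⁻¹ (spineFun s w) = w := by
  induction w with
  | nil => rfl
  | cons x w ih =>
    by_cases h : x.val < p - 1
    · simp [spineFun, h]
    · simp [spineFun, h, ih]

theorem spineFun_prefix_iff {p : ℕ} (s : Fin (p - 1) → TreeAut (ZMod p))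
    (u v : List (ZMod p)) : spineFun s u <+: spineFun s v ↔ u <+: v := by
  induction u generalizing v with
  | nil => simp [spineFun]
  | cons x u ih =>
    cases v with
    | nil => simp [spineFun]
    | cons y v =>
      simp only [spineFun, List.cons_prefix_cons]
      refine and_congr_right fun hxy => ?_
      subst hxy
      by_cases h : x.val < p - 1
      · simpa [h] using (s ⟨x.val, h⟩).map_rel_iff
      · simpa [h] using ih v

/-- The tree automorphism `f` that fixes the first level and satisfies
`f = (s₀, …, s_{p-2}, f)`. -/
def spine {p : ℕ} (s : Fin (p - 1) → TreeAut (ZMod p)) : TreeAut (ZMod p) where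
  toFun := spineFun s
  invFun := spineFun s⁻¹
  left_inv := spineFun_inv_spineFun s
  right_inv w := by simpa using spineFun_inv_spineFun s⁻¹ w
  map_rel_iff' {u v} := spineFun_prefix_iff s u v

/-- The automorphism `b = (a ^ e₀, …, a ^ e_{p-2}, b)`. Since `a ^ p = 1`, the power of `a` with
exponent in `𝔽_p` is computed from the representative in `{0, …, p - 1}`. -/
def b {p : ℕ} (e : Fin (p - 1) → ZMod p) : TreeAut (ZMod p) :=
  spine fun i => a p ^ (e i).val

/-- The group `G_e = ⟨a, b⟩` with defining vector `e`. -/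
def ggsGroup {p : ℕ} (e : Fin (p - 1) → ZMod p) : Subgroup (TreeAut (ZMod p)) :=
  Subgroup.closure {a p, b e}

/-- The profinite topology of an abstract group, generated by the cosets of its subgroups of
finite index. -/
abbrev profiniteTopology (G : Type*) [Group G] : TopologicalSpace G :=
  TopologicalSpace.generateFrom
    {s | ∃ (K : Subgroup G) (g : G), K.FiniteIndex ∧ s = g • (K : Set G)}

/-- Subgroup separable (LERF): every finitely generated subgroup is closed in the profinite
topology. -/
def SubgroupSeparable (G : Type*) [Group G] : Prop :=
  ∀ H : Subgroup G, H.FG → IsClosed[profiniteTopology G] (H : Set G)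

end GGS

/-! Separability results from combining two facts, both of which use that torsion forces the
defining vector to have sum zero (`sum_E_eq_zero`).

Finitely generated subgroups are tame (`tame_of_fg`): finitely many levels down, their sections are
finite or everything. Elements are measured by the number of powers of `b` they need, which roughly
halves in sections. If the generators fix the first level, their sections are shorter generators of
the sections of the subgroup. Otherwise the Schreier generators, for a transversal of powers of one
generator, may be about 3/2 times as long; but then, by `dense_or_le_St`, either the section fixes
the first level and a further section halves the length, or it surjects onto the abelianisation, and
such subgroups are tame by a separate induction (`Dense.tame`). The dichotomy is linear algebra: the
actions of the sections of an element are the convolution of their exponent sums with a translate of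
the defining vector, which is nilpotent in the group algebra of the cyclic group because its sum is
zero.

Subgroups normalised by a subgroup of finite index are separable (`normalSeparable`). The group is
regular branch over its second derived subgroup, which has finite index by torsion. Double
commutators then show that, below finitely many levels, such a subgroup is either trivial in its
sections or contains a finite index part of the rigid stabiliser.

If `H` is tame, some subgroup of finite index embeds in a finite power of the group so that `H` has
finite or finite index projections (`Tame.hasCoordinates`). Peeling off one coordinate at a time
(`Separable.of_prod`), the kernels that arise are finite or normalised by a subgroup of finite
index, hence separable. -/

namespace GGS

open scoped Pointwise Topology commutatorElement

/-! ### Separable subgroups -/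

/-- A subgroup is separable if it is an intersection of subgroups of finite index. -/
def Separable {Γ : Type*} [Group Γ] (K : Subgroup Γ) : Prop :=
  ∀ g ∉ K, ∃ F : Subgroup Γ, F.FiniteIndex ∧ K ≤ F ∧ g ∉ F

section Separable

variable {Γ Δ : Type*} [Group Γ] [Group Δ]

theorem Separable.isClosed {K : Subgroup Γ} (hK : Separable K) :
    IsClosed[profiniteTopology Γ] (K : Set Γ) := by
  let := profiniteTopology Γ
  rw [← isOpen_compl_iff, isOpen_iff_forall_mem_open]
  intro g hg
  obtain ⟨F, hF, hKF, hgF⟩ := hK g hg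
  refine ⟨g • (F : Set Γ), ?_, TopologicalSpace.isOpen_generateFrom_of_mem ⟨F, g, hF, rfl⟩,
    ⟨1, F.one_mem, by simp⟩⟩
  rintro _ ⟨f, hf, rfl⟩ hmem
  exact hgF (by simpa using F.mul_mem (hKF hmem) (F.inv_mem hf))

theorem Separable.of_finiteIndex {K : Subgroup Γ} (hK : K.FiniteIndex) : Separable K :=
  fun _ hg => ⟨K, hK, le_rfl, hg⟩

theorem finiteIndex_comap (f : Γ →* Δ) {F : Subgroup Δ} (hF : F.FiniteIndex) :
    (F.comap f).FiniteIndex :=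
  ⟨by rw [Subgroup.index_comap]; exact Subgroup.isFiniteRelIndex_of_finiteIndex.relIndex_ne_zero⟩

theorem Separable.comap {K : Subgroup Δ} (hK : Separable K) (f : Γ →* Δ) :
    Separable (K.comap f) := by
  intro g hg
  obtain ⟨F, hF, hKF, hgF⟩ := hK (f g) hg
  exact ⟨F.comap f, finiteIndex_comap f hF, Subgroup.comap_mono hKF, hgF⟩

theorem Separable.iInf {ι : Sort*} {K : ι → Subgroup Γ} (hK : ∀ i, Separable (K i)) :
    Separable (⨅ i, K i) := by
  intro g hg
  simp only [Subgroup.mem_iInf, not_forall] at hg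
  obtain ⟨i, hi⟩ := hg
  obtain ⟨F, hF, hKF, hgF⟩ := hK i g hi
  exact ⟨F, hF, (iInf_le K i).trans hKF, hgF⟩

theorem Separable.inf {K L : Subgroup Γ} (hK : Separable K) (hL : Separable L) :
    Separable (K ⊓ L) := by
  rw [inf_eq_iInf]
  exact Separable.iInf fun i => by cases i <;> assumption

theorem finiteIndex_map_subtype {A : Subgroup Γ} (hA : A.FiniteIndex) {K : Subgroup A}
    (hK : K.FiniteIndex) : (K.map A.subtype).FiniteIndex :=
  ⟨by rw [Subgroup.index_map_subtype]; exact mul_ne_zero hK.1 hA.1⟩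

theorem Separable.map_subtype {A : Subgroup Γ} (hA : A.FiniteIndex) {K : Subgroup A}
    (hK : Separable K) : Separable (K.map A.subtype) := by
  intro g hg
  by_cases hgA : g ∈ A
  · obtain ⟨F, hF, hKF, hgF⟩ := hK ⟨g, hgA⟩ fun h => hg ⟨_, h, rfl⟩
    refine ⟨F.map A.subtype, finiteIndex_map_subtype hA hF, Subgroup.map_mono hKF, ?_⟩
    rintro ⟨f, hf, rfl⟩
    exact hgF hf
  · exact ⟨A, hA, by rintro _ ⟨k, -, rfl⟩; exact k.2, hgA⟩

/-- `K` is a finite union of cosets `q K₀`, and each `q⁻¹ g` lies outside `K₀`. Separating these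
finitely many elements and passing to a normal core `M` of finite index gives `g ∉ K M`. -/
theorem Separable.of_relIndex {K₀ K : Subgroup Γ} (h₀ : Separable K₀) (hle : K₀ ≤ K)
    (hfin : K₀.relIndex K ≠ 0) : Separable K := by
  intro g hg
  have : Finite (K ⧸ K₀.subgroupOf K) := Subgroup.index_ne_zero_iff_finite.1 hfin
  have key : ∀ q : K ⧸ K₀.subgroupOf K, ∃ F : Subgroup Γ, F.FiniteIndex ∧ K₀ ≤ F ∧
      (q.out : Γ)⁻¹ * g ∉ F := fun q => h₀ _ fun h => hg <| by
    simpa using K.mul_mem q.out.2 (hle h)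
  choose F hF hKF hgF using key
  have hI : (⨅ q, F q).FiniteIndex := Subgroup.finiteIndex_iInf hF
  refine ⟨K ⊔ (⨅ q, F q).normalCore, Subgroup.finiteIndex_of_le le_sup_right, le_sup_left, ?_⟩
  intro hmem
  rw [← SetLike.mem_coe, Subgroup.mul_normal, Set.mem_mul] at hmem
  obtain ⟨k, hk, m, hm, rfl⟩ := hmem
  let q : K ⧸ K₀.subgroupOf K := ((⟨k, hk⟩ : K) : K ⧸ K₀.subgroupOf K)
  apply hgF q
  have h1 : (q.out : Γ)⁻¹ * k ∈ K₀ := by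
    have : (q.out : K)⁻¹ * ⟨k, hk⟩ ∈ K₀.subgroupOf K := by
      rw [← QuotientGroup.eq]; exact q.out_eq
    simpa [Subgroup.mem_subgroupOf] using this
  have h2 : m ∈ F q := iInf_le F q (Subgroup.normalCore_le _ hm)
  rw [← mul_assoc]
  exact (F q).mul_mem (hKF q h1) h2

theorem relIndex_map_ne_zero (f : Γ →* Δ) {K₀ K : Subgroup Γ} (h : K₀.relIndex K ≠ 0) :
    (K₀.map f).relIndex (K.map f) ≠ 0 := by
  rw [← Subgroup.relIndex_comap]
  exact fun h0 => h (Subgroup.relIndex_eq_zero_of_le_left (Subgroup.le_comap_map f K₀) h0)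

/-- A subgroup of a direct product is separable as soon as its kernel and the finite index subgroups
of its second projection are. -/
theorem Separable.of_prod {K : Subgroup (Γ × Δ)}
    (h₁ : Separable (K.comap (MonoidHom.inl Γ Δ)))
    (h₂ : ∀ D ≤ K.map (MonoidHom.snd Γ Δ), D.relIndex (K.map (MonoidHom.snd Γ Δ)) ≠ 0 →
      Separable D) : Separable K := by
  intro g hg
  by_cases hg2 : g.2 ∈ K.map (MonoidHom.snd Γ Δ)
  swap
  · obtain ⟨F, hF, hKF, hgF⟩ := h₂ _ le_rfl (by simp) _ hg2
    exact ⟨F.comap (MonoidHom.snd Γ Δ), finiteIndex_comap _ hF, Subgroup.map_le_iff_le_comap.1 hKF, hgF⟩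
  obtain ⟨⟨γ, q⟩, hγ, hq⟩ := hg2
  have hq' : q = g.2 := hq
  subst hq'
  -- Dividing `g` by an element of `K` with the same second coordinate leaves an element of the
  -- first factor outside the kernel.
  obtain ⟨E, hE, hNE, hgE⟩ := h₁ (γ⁻¹ * g.1) fun h => hg <| by
    simpa using K.mul_mem hγ (show ((γ⁻¹ * g.1, 1) : Γ × Δ) ∈ K from h)
  set M := E.normalCore with hM
  have : (M.comap (MonoidHom.fst Γ Δ)).FiniteIndex := finiteIndex_comap _ inferInstance
  -- Every element of `D` is the second coordinate of an element of `K` with first coordinate in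
  -- `M`. Hence `M × D` lies in `K (M × 1)`, with finite index, and the latter is separable.
  set D := (K ⊓ M.comap (MonoidHom.fst Γ Δ)).map (MonoidHom.snd Γ Δ) with hD
  have hDle : D ≤ K.map (MonoidHom.snd Γ Δ) := Subgroup.map_mono inf_le_left
  have hDfin : D.relIndex (K.map (MonoidHom.snd Γ Δ)) ≠ 0 := by
    apply relIndex_map_ne_zero
    rw [Subgroup.inf_relIndex_left]
    exact (Subgroup.isFiniteRelIndex_of_finiteIndex).relIndex_ne_zero
  have hDsep := h₂ D hDle hDfin
  let M' : Subgroup (Γ × Δ) := M.prod ⊥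
  have : M'.Normal := Subgroup.prod_normal _ _
  have hsepMD : Separable (M.prod D) := by
    have : M.prod D = M.comap (MonoidHom.fst Γ Δ) ⊓ D.comap (MonoidHom.snd Γ Δ) := rfl
    rw [this]
    exact (Separable.of_finiteIndex inferInstance).inf (hDsep.comap _)
  have hle : M.prod D ≤ K ⊔ M' := by
    rintro ⟨m, d⟩ ⟨hm, ⟨⟨m', d'⟩, ⟨hk, hm'⟩, hd⟩⟩
    have hd' : d' = d := hd
    subst hd'
    have : ((m, d') : Γ × Δ) = (m', d') * (m'⁻¹ * m, 1) := by simp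
    rw [this]
    exact mul_mem (Subgroup.mem_sup_left hk) (Subgroup.mem_sup_right
      ⟨M.mul_mem (M.inv_mem hm') hm, rfl⟩)
  have hfin : (M.prod D).relIndex (K ⊔ M') ≠ 0 := by
    have hle2 : K ⊔ M' ≤ (K.map (MonoidHom.snd Γ Δ)).comap (MonoidHom.snd Γ Δ) := by
      refine sup_le (Subgroup.le_comap_map _ _) ?_
      rintro ⟨m, d⟩ ⟨-, hd⟩
      have hd' : d = 1 := hd
      subst hd'
      exact (K.map (MonoidHom.snd Γ Δ)).one_mem
    intro h0
    refine Subgroup.relIndex_inf_ne_zero (H := M.comap (MonoidHom.fst Γ Δ))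
      (K := D.comap (MonoidHom.snd Γ Δ)) ?_ ?_ (Subgroup.relIndex_eq_zero_of_le_right hle2 h0)
    · exact (Subgroup.isFiniteRelIndex_of_finiteIndex).relIndex_ne_zero
    · exact Subgroup.relIndex_comap_ne_zero _ hDfin
  -- If `g` were in `K (M × 1)`, then `γ⁻¹ * g.1` would be in the kernel times `M`, hence in `E`.
  obtain ⟨F, hF, hKF, hgF⟩ := (hsepMD.of_relIndex hle hfin) g (by
    intro hmem
    rw [← SetLike.mem_coe, Subgroup.mul_normal, Set.mem_mul] at hmem
    obtain ⟨k, hk, ⟨m, d⟩, ⟨hm, hd⟩, hkm⟩ := hmem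
    have hd' : d = 1 := hd
    subst hd'
    have hk' : k = (g.1 * m⁻¹, g.2) := by rw [← hkm]; ext <;> simp
    subst hk'
    have : ((γ⁻¹ * (g.1 * m⁻¹), 1) : Γ × Δ) ∈ K := by
      simpa using K.mul_mem (K.inv_mem hγ) hk
    have h3 : γ⁻¹ * (g.1 * m⁻¹) ∈ E := hNE this
    apply hgE
    simpa [mul_assoc] using E.mul_mem h3 (Subgroup.normalCore_le _ hm))
  exact ⟨F, hF, le_sup_left.trans hKF, hgF⟩

/-- The subgroup is finite or has finite index. -/
def FiniteOrCofinite (K : Subgroup Γ) : Prop := Finite K ∨ K.FiniteIndex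

theorem FiniteOrCofinite.of_relIndex {K₀ K : Subgroup Γ} (hK : FiniteOrCofinite K) (hle : K₀ ≤ K)
    (h : K₀.relIndex K ≠ 0) : FiniteOrCofinite K₀ := by
  rcases hK with hK | hK
  · exact Or.inl (Finite.Set.subset (K : Set Γ) hle)
  · refine Or.inr ⟨?_⟩
    rw [← Subgroup.relIndex_mul_index hle]
    exact mul_ne_zero h hK.1

/-- Every subgroup normalised by a subgroup of finite index is separable. -/
def NormalSeparable (Γ : Type*) [Group Γ] : Prop :=
  ∀ A N : Subgroup Γ, A.FiniteIndex → (∀ g ∈ A, ∀ n ∈ N, g * n * g⁻¹ ∈ N) → Separable N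

theorem NormalSeparable.of_finite (hΓ : NormalSeparable Γ) {N : Subgroup Γ} (hN : Finite N) :
    Separable N := by
  have h1 : Separable (⊥ : Subgroup Γ) := hΓ ⊤ ⊥ inferInstance (by simp)
  refine h1.of_relIndex bot_le ?_
  rw [Subgroup.relIndex_bot_left]
  exact Nat.card_pos.ne'

/-- The kernel of forgetting the first coordinate is normalised by the first projection of `K`. If
that projection is finite, so is the kernel; if it has finite index, normal separability applies.
The hypothesis passes to finite index subgroups of the remaining projection, so induction takes
over. -/
theorem NormalSeparable.separable_pi_fin (hΓ : NormalSeparable Γ) (n : ℕ)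
    (K : Subgroup (Fin n → Γ))
    (hK : ∀ i, FiniteOrCofinite (K.map (Pi.evalMonoidHom (fun _ : Fin n => Γ) i))) :
    Separable K := by
  induction n with
  | zero => exact fun g hg => (hg (by rw [Subsingleton.elim g 1]; exact K.one_mem)).elim
  | succ n ih =>
    let f : (Fin (n + 1) → Γ) →* Γ × (Fin n → Γ) :=
      (Pi.evalMonoidHom _ 0).prod (MonoidHom.pi fun i => Pi.evalMonoidHom _ i.succ)
    have hf : Function.Injective f := by
      intro u v huv
      have h0 : u 0 = v 0 := congrArg Prod.fst huv
      have hs : ∀ i : Fin n, u i.succ = v i.succ := congrFun (congrArg Prod.snd huv)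
      funext i
      exact Fin.cases h0 hs i
    rw [← Subgroup.comap_map_eq_self_of_injective hf K]
    refine Separable.comap (Separable.of_prod ?_ ?_) f
    · have hnorm : ∀ g ∈ K.map (Pi.evalMonoidHom (fun _ : Fin (n + 1) => Γ) 0),
          ∀ m ∈ (K.map f).comap (MonoidHom.inl Γ (Fin n → Γ)),
          g * m * g⁻¹ ∈ (K.map f).comap (MonoidHom.inl Γ (Fin n → Γ)) := by
        rintro _ ⟨k, hk, rfl⟩ m hm
        have hm' : ((m, 1) : Γ × (Fin n → Γ)) ∈ K.map f := hm
        have hk' : f k ∈ K.map f := ⟨k, hk, rfl⟩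
        have := mul_mem (mul_mem hk' hm') (inv_mem hk')
        have heq : f k * (m, 1) * (f k)⁻¹ = (k 0 * m * (k 0)⁻¹, 1) := by
          ext <;> simp [f]
        rw [heq] at this
        exact this
      rcases hK 0 with h | h
      · refine hΓ.of_finite (Finite.Set.subset (K.map (Pi.evalMonoidHom _ 0) : Set Γ) ?_)
        rintro m ⟨k, hk, hkm⟩
        exact ⟨k, hk, congrArg Prod.fst hkm⟩
      · exact hΓ _ _ h hnorm
    · intro D hD hfin
      refine ih D fun i => ?_
      have hle : D.map (Pi.evalMonoidHom (fun _ : Fin n => Γ) i) ≤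
          ((K.map f).map (MonoidHom.snd Γ (Fin n → Γ))).map (Pi.evalMonoidHom _ i) :=
        Subgroup.map_mono hD
      refine FiniteOrCofinite.of_relIndex ?_ hle (relIndex_map_ne_zero _ hfin)
      rw [Subgroup.map_map, Subgroup.map_map]
      exact hK i.succ

/-- In a power of a normal-separable group, a subgroup all of whose projections are finite or of
finite index is separable. -/
theorem NormalSeparable.separable_pi (hΓ : NormalSeparable Γ) {ι : Type*} [Finite ι]
    (K : Subgroup (ι → Γ))
    (hK : ∀ i, FiniteOrCofinite (K.map (Pi.evalMonoidHom (fun _ : ι => Γ) i))) :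
    Separable K := by
  obtain ⟨n, ⟨e⟩⟩ := Finite.exists_equiv_fin ι
  let f : (ι → Γ) →* (Fin n → Γ) := MonoidHom.pi fun i => Pi.evalMonoidHom _ (e.symm i)
  have hf : Function.Injective f := by
    intro u v huv
    funext i
    have h : u (e.symm (e i)) = v (e.symm (e i)) := congrFun huv (e i)
    simpa using h
  rw [← Subgroup.comap_map_eq_self_of_injective hf K]
  refine (hΓ.separable_pi_fin n _ fun i => ?_).comap f
  rw [Subgroup.map_map]
  exact hK (e.symm i)

end Separable

/-! ### Sections of tree automorphisms -/

namespace TreeAut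

variable {X : Type*}

theorem apply_nil (g : TreeAut X) : g [] = [] := by
  have h : [] <+: g.symm [] := List.nil_prefix
  have h2 := g.map_rel_iff.2 h
  rw [RelIso.apply_symm_apply] at h2
  exact List.prefix_nil.1 h2

theorem length_le_length_apply (g : TreeAut X) (w : List X) : w.length ≤ (g w).length := by
  induction w using List.reverseRecOn with
  | nil => simp
  | append_singleton u x ih =>
    have h : g u <+: g (u ++ [x]) := g.map_rel_iff.2 (List.prefix_append u [x])
    have hne : (g u).length ≠ (g (u ++ [x])).length := fun hl => by
      have := g.injective (h.eq_of_length hl)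
      simp at this
    have := h.length_le
    simp only [List.length_append, List.length_singleton]
    omega

theorem length_apply (g : TreeAut X) (w : List X) : (g w).length = w.length := by
  refine le_antisymm ?_ (length_le_length_apply g w)
  simpa using length_le_length_apply g.symm (g w)

/-- The action of a tree automorphism on the first level. -/
def root (g : TreeAut X) (x : X) : X := (g [x]).headD x

theorem apply_singleton (g : TreeAut X) (x : X) : g [x] = [root g x] := by
  obtain ⟨y, hy⟩ := List.length_eq_one_iff.1 (length_apply g [x])
  simp [root, hy]

theorem apply_cons (g : TreeAut X) (x : X) (w : List X) :
    g (x :: w) = root g x :: (g (x :: w)).tail := by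
  have h : g [x] <+: g (x :: w) := g.map_rel_iff.2 ⟨w, rfl⟩
  rw [apply_singleton] at h
  obtain ⟨t, ht⟩ := h
  rw [← ht]
  rfl

theorem root_symm_root (g : TreeAut X) (x : X) : root g.symm (root g x) = x := by
  have h : g.symm (g [x]) = [x] := by simp
  rw [apply_singleton, apply_singleton] at h
  simpa using h

theorem symm_cons_tail (g : TreeAut X) (x : X) (w : List X) :
    (g.symm (root g x :: (g (x :: w)).tail)).tail = w := by
  rw [← apply_cons, RelIso.symm_apply_apply, List.tail_cons]

/-- The section of a tree automorphism at a letter. -/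
def sectionAt (g : TreeAut X) (x : X) : TreeAut X where
  toFun w := (g (x :: w)).tail
  invFun w := (g.symm (root g x :: w)).tail
  left_inv w := symm_cons_tail g x w
  right_inv w := by
    have h := symm_cons_tail g.symm (root g x) w
    rwa [root_symm_root] at h
  map_rel_iff' {u v} := by
    have h := g.map_rel_iff (a := x :: u) (b := x :: v)
    rw [apply_cons g x u, apply_cons g x v] at h
    rw [List.cons_prefix_cons, List.cons_prefix_cons] at h
    simp only [true_and] at h
    exact h

theorem apply_cons_sectionAt (g : TreeAut X) (x : X) (w : List X) :
    g (x :: w) = root g x :: sectionAt g x w := apply_cons g x w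

theorem root_mul (g h : TreeAut X) (x : X) : root (g * h) x = root g (root h x) := by
  have h1 : (g * h) [x] = g (h [x]) := rfl
  rw [apply_singleton, apply_singleton, apply_singleton] at h1
  simpa using h1

theorem sectionAt_mul (g h : TreeAut X) (x : X) :
    sectionAt (g * h) x = sectionAt g (root h x) * sectionAt h x := by
  ext1 w
  have h1 : (g * h) (x :: w) = g (h (x :: w)) := rfl
  rw [apply_cons_sectionAt, apply_cons_sectionAt, apply_cons_sectionAt] at h1
  exact (List.cons.inj h1).2

theorem root_one (x : X) : root (1 : TreeAut X) x = x := rfl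

theorem sectionAt_one (x : X) : sectionAt (1 : TreeAut X) x = 1 := rfl

theorem root_inv (g : TreeAut X) (x : X) : root g⁻¹ (root g x) = x := root_symm_root g x

theorem sectionAt_inv (g : TreeAut X) (x : X) :
    sectionAt g⁻¹ (root g x) = (sectionAt g x)⁻¹ := by
  have h := sectionAt_mul g⁻¹ g x
  rw [inv_mul_cancel, sectionAt_one] at h
  exact eq_inv_of_mul_eq_one_left h.symm

/-- Iterated sections. -/
def sections (g : TreeAut X) : List X → TreeAut X
  | [] => g
  | x :: w => sections (sectionAt g x) w

theorem eq_one_of_root_sections {g : TreeAut X} (h : ∀ w x, root (sections g w) x = x) :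
    g = 1 := by
  ext1 w
  change g w = w
  induction w generalizing g with
  | nil => exact apply_nil g
  | cons x w ih =>
    rw [apply_cons_sectionAt, show root g x = x from h [] x, ih fun v y => h (x :: v) y]

end TreeAut

/-! ### The abstract setting -/

/-- A self-similar action on the `p`-regular rooted tree of a group generated by `a`, which permutes
the first level cyclically, and `b`, with sections `b` at `-1` and `a ^ E x` at the other `x`. -/
structure GGSData (p : ℕ) (E : ZMod p → ZMod p) (G : Type*) [Group G] where
  /-- the rooted generator -/
  a : G
  /-- the directed generator -/
  b : G
  /-- the translation by which an element acts on the first level -/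
  act : G → ZMod p
  /-- the section at a letter -/
  sec : G → ZMod p → G
  act_mul : ∀ g h, act (g * h) = act g + act h
  sec_mul : ∀ g h x, sec (g * h) x = sec g (x + act h) * sec h x
  act_a : act a = 1
  sec_a : ∀ x, sec a x = 1
  act_b : act b = 0
  sec_b : ∀ x, sec b x = if x = -1 then b else a ^ (E x).val
  E_neg_one : E (-1) = 0
  E_ne_zero : E ≠ 0
  closure_eq_top : Subgroup.closure {a, b} = ⊤
  faithful : ∀ g, (∀ w : List (ZMod p), act (w.foldl sec g) = 0) → g = 1

/-! ### The concrete group `G_e` as an instance of the abstract setting. -/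

section Concrete

variable {p : ℕ}

theorem root_a (x : ZMod p) : TreeAut.root (a p) x = x + 1 := rfl

theorem section_a (x : ZMod p) : TreeAut.sectionAt (a p) x = 1 := rfl

theorem root_b (e : Fin (p - 1) → ZMod p) (x : ZMod p) : TreeAut.root (b e) x = x := rfl

/-- The defining vector, extended by `0` at the last letter. -/
def extend (e : Fin (p - 1) → ZMod p) (x : ZMod p) : ZMod p :=
  if h : x.val < p - 1 then e ⟨x.val, h⟩ else 0

theorem val_lt_pred_iff [NeZero p] (x : ZMod p) : x.val < p - 1 ↔ x ≠ -1 := by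
  obtain ⟨n, rfl⟩ := Nat.exists_eq_succ_of_ne_zero (NeZero.ne p)
  have h1 : (-1 : ZMod (n + 1)).val = n := ZMod.val_neg_one n
  have h2 := ZMod.val_lt x
  constructor
  · rintro h rfl
    change (-1 : ZMod (n + 1)).val < _ at h
    omega
  · intro h
    have : x.val ≠ n := fun h3 => h (ZMod.val_injective _ (h3.trans h1.symm))
    simp only [Nat.succ_eq_add_one] at *
    omega

theorem section_b [NeZero p] (e : Fin (p - 1) → ZMod p) (x : ZMod p) :
    TreeAut.sectionAt (b e) x = if x = -1 then b e else a p ^ (extend e x).val := by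
  ext1 w
  change (spineFun _ (x :: w)).tail = _
  rw [spineFun, List.tail_cons]
  by_cases h : x.val < p - 1
  · rw [dif_pos h, if_neg ((val_lt_pred_iff x).1 h), extend, dif_pos h]
  · rw [dif_neg h, if_pos (not_not.1 ((val_lt_pred_iff x).not.1 h))]
    rfl

theorem extend_neg_one [NeZero p] (e : Fin (p - 1) → ZMod p) : extend e (-1) = 0 :=
  dif_neg fun h => (val_lt_pred_iff _).1 h rfl

theorem extend_ne_zero [NeZero p] {e : Fin (p - 1) → ZMod p} (he : e ≠ 0) : extend e ≠ 0 := by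
  obtain ⟨i, hi⟩ := Function.ne_iff.1 he
  intro h
  apply hi
  have h1 := congrFun h ((i : ℕ) : ZMod p)
  have h2 : ((i : ℕ) : ZMod p).val = i := ZMod.val_cast_of_lt (i.2.trans_le (Nat.sub_le _ _))
  rw [extend, dif_pos (by rw [h2]; exact i.2)] at h1
  simpa [h2] using h1

theorem ggsGroup_selfSimilar [NeZero p] (e : Fin (p - 1) → ZMod p) {g : TreeAut (ZMod p)}
    (hg : g ∈ ggsGroup e) :
    (∀ x, TreeAut.root g x = x + TreeAut.root g 0) ∧
      ∀ x, TreeAut.sectionAt g x ∈ ggsGroup e := by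
  have ha : a p ∈ ggsGroup e := Subgroup.subset_closure (by simp)
  have hb : b e ∈ ggsGroup e := Subgroup.subset_closure (by simp)
  induction hg using Subgroup.closure_induction with
  | mem g hg =>
    rcases hg with rfl | rfl
    · exact ⟨fun x => by simp [root_a], fun x => by rw [section_a]; exact one_mem _⟩
    · refine ⟨fun x => by simp [root_b], fun x => ?_⟩
      rw [section_b]
      split_ifs
      exacts [hb, pow_mem ha _]
  | one => exact ⟨fun x => by simp [TreeAut.root_one], fun x => one_mem _⟩
  | mul g h _ _ ihg ihh =>
    refine ⟨fun x => ?_, fun x => ?_⟩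
    · rw [TreeAut.root_mul, TreeAut.root_mul, ihg.1, ihh.1, ihg.1 (TreeAut.root h 0), add_assoc]
    · rw [TreeAut.sectionAt_mul]
      exact mul_mem (ihg.2 _) (ihh.2 _)
  | inv g _ ih =>
    have key : ∀ x, TreeAut.root g⁻¹ x = x - TreeAut.root g 0 := fun x => by
      have := TreeAut.root_inv g (x - TreeAut.root g 0)
      rwa [ih.1, sub_add_cancel] at this
    refine ⟨fun x => by rw [key, key 0]; ring, fun x => ?_⟩
    have := TreeAut.sectionAt_inv g (x - TreeAut.root g 0)
    rw [ih.1, sub_add_cancel] at this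
    rw [this]
    exact inv_mem (ih.2 _)

/-- The group `G_e` as an abstract self-similar group. -/
def ggsData [NeZero p] {e : Fin (p - 1) → ZMod p} (he : e ≠ 0) :
    GGSData p (extend e) (ggsGroup e) where
  a := ⟨a p, Subgroup.subset_closure (by simp)⟩
  b := ⟨b e, Subgroup.subset_closure (by simp)⟩
  act g := TreeAut.root g.1 0
  sec g x := ⟨TreeAut.sectionAt g.1 x, (ggsGroup_selfSimilar e g.2).2 x⟩
  act_mul g h := by
    rw [Subgroup.coe_mul, TreeAut.root_mul, (ggsGroup_selfSimilar e g.2).1, add_comm]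
  sec_mul g h x := by
    apply Subtype.ext
    simp only [Subgroup.coe_mul]
    rw [TreeAut.sectionAt_mul, (ggsGroup_selfSimilar e h.2).1]
  act_a := by simp [root_a]
  sec_a x := rfl
  act_b := by simp [root_b]
  sec_b x := by
    apply Subtype.ext
    simp only [section_b]
    split_ifs <;> rfl
  E_neg_one := extend_neg_one e
  E_ne_zero := extend_ne_zero he
  closure_eq_top := by
    have h : Subgroup.closure ((↑) ⁻¹' {a p, b e} : Set (ggsGroup e)) = ⊤ :=
      Subgroup.closure_closure_coe_preimage
    refine Eq.trans ?_ h
    congr 1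
    ext g
    simp only [Set.mem_insert_iff, Set.mem_singleton_iff, Set.mem_preimage, Subtype.ext_iff]
  faithful g h := by
    apply Subtype.ext
    apply TreeAut.eq_one_of_root_sections
    have key : ∀ (w : List (ZMod p)) (g : ggsGroup e),
        ((w.foldl (fun (g : ggsGroup e) x =>
          (⟨TreeAut.sectionAt g.1 x, (ggsGroup_selfSimilar e g.2).2 x⟩ : ggsGroup e)) g :
            ggsGroup e) : TreeAut (ZMod p)) = TreeAut.sections g.1 w := by
      intro w
      induction w with
      | nil => intro g; rfl
      | cons x w ih => intro g; exact ih _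
    intro w x
    have h1 := h w
    rw [key] at h1
    have h2 := (ggsGroup_selfSimilar e (w.foldl (fun (g : ggsGroup e) x =>
          (⟨TreeAut.sectionAt g.1 x, (ggsGroup_selfSimilar e g.2).2 x⟩ : ggsGroup e)) g).2).1 x
    rw [key, h1, add_zero] at h2
    exact h2

end Concrete

namespace GGSData

variable {p : ℕ} [hp : Fact p.Prime] {E : ZMod p → ZMod p} {G : Type*} [Group G]
  (D : GGSData p E G)

/-! ### Elementary properties -/

theorem act_one : D.act 1 = 0 := by
  have := D.act_mul 1 1
  rw [mul_one] at this
  simpa using this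

theorem act_inv (g : G) : D.act g⁻¹ = -D.act g := by
  have := D.act_mul g⁻¹ g
  rw [inv_mul_cancel, act_one] at this
  exact eq_neg_of_add_eq_zero_left this.symm

theorem act_pow (g : G) (n : ℕ) : D.act (g ^ n) = n * D.act g := by
  induction n with
  | zero => simp [act_one]
  | succ n ih => rw [pow_succ, act_mul, ih]; push_cast; ring

theorem act_conj (g h : G) : D.act (g * h * g⁻¹) = D.act h := by
  rw [act_mul, act_mul, act_inv]; ring

theorem sec_one (x : ZMod p) : D.sec 1 x = 1 := by
  have := D.sec_mul 1 1 x
  rw [mul_one, act_one, add_zero] at this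
  exact left_eq_mul.1 this

theorem sec_inv (g : G) (x : ZMod p) : D.sec g⁻¹ x = (D.sec g (x - D.act g))⁻¹ := by
  have := D.sec_mul g g⁻¹ x
  rw [mul_inv_cancel, sec_one, act_inv, ← sub_eq_add_neg] at this
  exact eq_inv_of_mul_eq_one_right this.symm

theorem sec_conj (g h : G) (x : ZMod p) :
    D.sec (g * h * g⁻¹) (x + D.act g) =
      D.sec g (x + D.act h) * D.sec h x * (D.sec g x)⁻¹ := by
  rw [sec_mul, sec_mul, sec_inv, act_inv]
  simp

/-- The stabiliser of the first level. -/
def St : Subgroup G where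
  carrier := {g | D.act g = 0}
  one_mem' := D.act_one
  mul_mem' {g h} hg hh := by
    simp only [Set.mem_ofPred_eq] at *
    rw [act_mul, hg, hh, add_zero]
  inv_mem' {g} hg := by
    simp only [Set.mem_ofPred_eq] at *
    rw [act_inv, hg, neg_zero]

theorem mem_St {g : G} : g ∈ D.St ↔ D.act g = 0 := Iff.rfl

/-- The section at `x` as a homomorphism on the first level stabiliser. -/
def secHom (x : ZMod p) : D.St →* G where
  toFun g := D.sec g x
  map_one' := D.sec_one x
  map_mul' g h := by
    rw [Subgroup.coe_mul, sec_mul, show D.act (h : G) = 0 from h.2, add_zero]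

theorem sec_pow_of_act {g : G} (hg : D.act g = 0) (n : ℕ) (x : ZMod p) :
    D.sec (g ^ n) x = D.sec g x ^ n := by
  induction n with
  | zero => simp [sec_one]
  | succ n ih => rw [pow_succ, sec_mul, hg, add_zero, ih, pow_succ]

theorem eq_one_of_sec {g : G} (h0 : D.act g = 0) (h : ∀ x, D.sec g x = 1) : g = 1 := by
  have h1 : ∀ w : List (ZMod p), w.foldl D.sec 1 = 1 := fun w => by
    induction w with
    | nil => rfl
    | cons x w ih => rw [List.foldl_cons, sec_one, ih]
  refine D.faithful g fun w => ?_
  cases w with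
  | nil => exact h0
  | cons x w => rw [List.foldl_cons, h, h1, act_one]

theorem eq_of_sec {g h : G} (h0 : D.act g = D.act h) (hs : ∀ x, D.sec g x = D.sec h x) :
    g = h := by
  rw [← mul_inv_eq_one]
  refine D.eq_one_of_sec (by rw [act_mul, act_inv, h0]; ring) fun x => ?_
  rw [sec_mul, sec_inv, act_inv, ← sub_eq_add_neg, hs, mul_inv_cancel]

/-! ### Powers of the generators with exponents in `ZMod p` -/

theorem act_a_pow (n : ℕ) : D.act (D.a ^ n) = n := by rw [act_pow, act_a, mul_one]

theorem sec_a_pow (n : ℕ) (x : ZMod p) : D.sec (D.a ^ n) x = 1 := by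
  induction n generalizing x with
  | zero => simp [sec_one]
  | succ n ih => rw [pow_succ, sec_mul, sec_a, mul_one, ih]

theorem a_pow_p : D.a ^ p = 1 :=
  D.eq_one_of_sec (by rw [act_a_pow]; simp) fun x => D.sec_a_pow p x

/-- Since `a ^ p = 1`, every iterated section of `b ^ p` is `b ^ p` or `1`, and neither moves the
first level. -/
theorem b_pow_p : D.b ^ p = 1 := by
  refine D.faithful _ fun w => ?_
  have key : ∀ w : List (ZMod p), w.foldl D.sec (D.b ^ p) = D.b ^ p ∨
      w.foldl D.sec (D.b ^ p) = 1 := by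
    intro w
    induction w using List.reverseRecOn with
    | nil => exact Or.inl rfl
    | append_singleton w x ih =>
      rw [List.foldl_append, List.foldl_cons, List.foldl_nil]
      rcases ih with h | h
      · rw [h, D.sec_pow_of_act D.act_b, sec_b]
        split_ifs
        · exact Or.inl rfl
        · right
          rw [← pow_mul, mul_comm, pow_mul, a_pow_p, one_pow]
      · rw [h, sec_one]; exact Or.inr rfl
  rcases key w with h | h
  · rw [h, act_pow, act_b, mul_zero]
  · rw [h, act_one]

/-- `a ^ k` for `k : ZMod p`. -/
def A (k : ZMod p) : G := D.a ^ k.val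

/-- `b ^ k` for `k : ZMod p`. -/
def B (k : ZMod p) : G := D.b ^ k.val

theorem pow_val_add {g : G} (hg : g ^ p = 1) (j k : ZMod p) :
    g ^ (j + k).val = g ^ j.val * g ^ k.val := by
  rw [ZMod.val_add, ← pow_add, ← pow_eq_pow_mod _ hg]

theorem A_add (j k : ZMod p) : D.A (j + k) = D.A j * D.A k := pow_val_add D.a_pow_p j k

theorem B_add (j k : ZMod p) : D.B (j + k) = D.B j * D.B k := pow_val_add D.b_pow_p j k

@[simp] theorem A_zero : D.A 0 = 1 := by simp [A]

@[simp] theorem B_zero : D.B 0 = 1 := by simp [B]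

theorem A_neg (k : ZMod p) : D.A (-k) = (D.A k)⁻¹ :=
  eq_inv_of_mul_eq_one_left (by rw [← A_add]; simp)

theorem B_neg (k : ZMod p) : D.B (-k) = (D.B k)⁻¹ :=
  eq_inv_of_mul_eq_one_left (by rw [← B_add]; simp)

theorem A_one : D.A 1 = D.a := by
  have : Fact (1 < p) := ⟨hp.out.one_lt⟩
  simp [A, ZMod.val_one]

theorem B_one : D.B 1 = D.b := by
  have : Fact (1 < p) := ⟨hp.out.one_lt⟩
  simp [B, ZMod.val_one]

theorem A_mul (j k : ZMod p) : D.A (j * k) = D.A j ^ k.val := by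
  rw [A, A, ← pow_mul, ZMod.val_mul, ← pow_eq_pow_mod _ D.a_pow_p]

theorem B_mul (j k : ZMod p) : D.B (j * k) = D.B j ^ k.val := by
  rw [B, B, ← pow_mul, ZMod.val_mul, ← pow_eq_pow_mod _ D.b_pow_p]

@[simp] theorem act_A (k : ZMod p) : D.act (D.A k) = k := by simp [A, act_a_pow]

@[simp] theorem act_B (k : ZMod p) : D.act (D.B k) = 0 := by simp [B, act_pow, act_b]

@[simp] theorem sec_A (k x : ZMod p) : D.sec (D.A k) x = 1 := D.sec_a_pow _ _

theorem sec_B (k x : ZMod p) :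
    D.sec (D.B k) x = if x = -1 then D.B k else D.A (E x * k) := by
  rw [B, D.sec_pow_of_act D.act_b, sec_b]
  split_ifs
  · rfl
  · rw [A_mul]; rfl

theorem a_mem_of_A_mem {H : Subgroup G} {k : ZMod p} (hk : k ≠ 0) (h : D.A k ∈ H) : D.a ∈ H := by
  rw [← A_one, ← mul_inv_cancel₀ hk, A_mul]
  exact pow_mem h _

theorem b_mem_of_B_mem {H : Subgroup G} {k : ZMod p} (hk : k ≠ 0) (h : D.B k ∈ H) : D.b ∈ H := by
  rw [← B_one, ← mul_inv_cancel₀ hk, B_mul]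
  exact pow_mem h _

theorem eq_top_of_mem {H : Subgroup G} (ha : D.a ∈ H) (hb : D.b ∈ H) : H = ⊤ := by
  rw [eq_top_iff, ← D.closure_eq_top, Subgroup.closure_le]
  rintro _ (rfl | rfl) <;> assumption

/-! ### Syllable length -/

/-- The elements that are products of powers of `a` and at most `n` powers of `b`. The second
component records the exponent sum of `b`. -/
inductive Word : ℕ → G → ZMod p → Prop
  | base (k : ZMod p) : Word 0 (D.A k) 0
  | step {n : ℕ} {g : G} {i : ZMod p} (j k : ZMod p) (h : Word n g i) :
      Word (n + 1) (g * D.B j * D.A k) (i + j)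

variable {D}

theorem Word.succ {n : ℕ} {g : G} {i : ZMod p} (h : D.Word n g i) : D.Word (n + 1) g i := by
  simpa using Word.step 0 0 h

theorem Word.mono {m n : ℕ} (hmn : m ≤ n) {g : G} {i : ZMod p} (h : D.Word m g i) :
    D.Word n g i := by
  induction hmn with
  | refl => exact h
  | step _ ih => exact ih.succ

theorem Word.mul_A {n : ℕ} {g : G} {i : ZMod p} (h : D.Word n g i) (k : ZMod p) :
    D.Word n (g * D.A k) i := by
  cases h with
  | base l => rw [← A_add]; exact Word.base _
  | step j l h => rw [mul_assoc, ← A_add]; exact Word.step _ _ h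

theorem Word.mul_B {n : ℕ} {g : G} {i : ZMod p} (h : D.Word n g i) (k : ZMod p) :
    D.Word (n + 1) (g * D.B k) (i + k) := by
  simpa using Word.step k 0 h

theorem Word.mul {m n : ℕ} {g h : G} {i j : ZMod p} (hg : D.Word m g i) (hh : D.Word n h j) :
    D.Word (m + n) (g * h) (i + j) := by
  induction hh with
  | base k => simpa using hg.mul_A k
  | step j k _ ih =>
    rw [← mul_assoc, ← mul_assoc, ← add_assoc, ← add_assoc]
    exact Word.step j k ih

theorem Word.of_B (k : ZMod p) : D.Word 1 (D.B k) k := by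
  simpa using (Word.base (D := D) 0).mul_B k

theorem Word.inv {n : ℕ} {g : G} {i : ZMod p} (h : D.Word n g i) : D.Word n g⁻¹ (-i) := by
  induction h with
  | base k => rw [← A_neg, neg_zero]; exact Word.base _
  | @step n g i j k _ ih =>
    have h1 := ((Word.base (D := D) (-k)).mul_B (-j)).mul ih
    rw [A_neg, B_neg] at h1
    have e1 : (g * D.B j * D.A k)⁻¹ = (D.A k)⁻¹ * (D.B j)⁻¹ * g⁻¹ := by group
    rw [e1, neg_add, add_comm (-i), add_comm n 1]
    simpa using h1

variable (D) in
theorem exists_word (g : G) : ∃ n i, D.Word n g i := by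
  have hg : g ∈ Subgroup.closure {D.a, D.b} := by rw [closure_eq_top]; trivial
  induction hg using Subgroup.closure_induction with
  | mem g hg =>
    rcases hg with rfl | rfl
    · exact ⟨0, 0, by rw [← A_one]; exact Word.base 1⟩
    · exact ⟨1, 1, by rw [← B_one]; exact Word.of_B 1⟩
  | one => exact ⟨0, 0, by rw [← D.A_zero]; exact Word.base 0⟩
  | mul g h _ _ ihg ihh =>
    obtain ⟨m, i, hg⟩ := ihg
    obtain ⟨n, j, hh⟩ := ihh
    exact ⟨_, _, hg.mul hh⟩
  | inv g _ ih =>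
    obtain ⟨m, i, hg⟩ := ih
    exact ⟨_, _, hg.inv⟩

theorem Word.zero {g : G} {i : ZMod p} (h : D.Word 0 g i) : ∃ k, g = D.A k := by
  cases h with
  | base k => exact ⟨k, rfl⟩

theorem Word.one {g : G} {i : ZMod p} (h : D.Word 1 g i) :
    ∃ k l, g = D.A k * D.B i * D.A l := by
  cases h with
  | step j l h =>
    cases h with
    | base k => exact ⟨k, l, by rw [zero_add]⟩

theorem word_sec_B (j x : ZMod p) :
    D.Word (if x = -1 then 1 else 0) (D.sec (D.B j) x) (if x = -1 then j else 0) := by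
  rw [sec_B]
  split_ifs
  exacts [Word.of_B j, Word.base _]

theorem sec_mul_B_mul_A (g : G) (j k x : ZMod p) :
    D.sec (g * D.B j * D.A k) x = D.sec g (x + k) * D.sec (D.B j) (x + k) := by
  rw [sec_mul, sec_A, mul_one, act_A, sec_mul, act_B, add_zero]

theorem sum_shift {M : Type*} [AddCommMonoid M] (f : ZMod p → M) (k : ZMod p) :
    ∑ x, f (x + k) = ∑ x, f x :=
  Equiv.sum_comp (Equiv.addRight k) f

theorem Word.sections {n : ℕ} {g : G} {i : ZMod p} (h : D.Word n g i) :
    ∃ (m : ZMod p → ℕ) (j : ZMod p → ZMod p), (∀ x, D.Word (m x) (D.sec g x) (j x)) ∧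
      ∑ x, m x = n ∧ ∑ x, j x = i := by
  induction h with
  | base k =>
    refine ⟨fun _ => 0, fun _ => 0, fun x => ?_, by simp, by simp⟩
    rw [sec_A, ← D.A_zero]
    exact Word.base 0
  | step l k _ ih =>
    obtain ⟨m, j, hw, hm, hj⟩ := ih
    refine ⟨fun x => m (x + k) + if x + k = -1 then 1 else 0,
      fun x => j (x + k) + if x + k = -1 then l else 0, fun x => ?_, ?_, ?_⟩
    · rw [sec_mul_B_mul_A]
      exact (hw _).mul (word_sec_B _ _)
    · rw [sum_shift fun x => m x + if x = -1 then 1 else 0, Finset.sum_add_distrib, hm]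
      simp
    · rw [sum_shift fun x => j x + if x = -1 then l else 0, Finset.sum_add_distrib, hj]
      simp

/-- Each power of `b` contributes a power of `b` to the section at exactly one letter. Two
consecutive ones separated by a nontrivial power of `a` contribute at different letters, so a
section receives at most one from each pair; if the separating power is trivial, the two merge. -/
theorem Word.sections_half {n : ℕ} {g : G} {i : ZMod p} (h : D.Word n g i) :
    ∃ j : ZMod p → ZMod p, (∀ x, D.Word ((n + 1) / 2) (D.sec g x) (j x)) ∧ ∑ x, j x = i := by
  induction n using Nat.strong_induction_on generalizing g i with
  | _ n ih =>
    by_cases hn : n < 2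
    · obtain ⟨m, j, hw, hm, hj⟩ := h.sections
      refine ⟨j, fun x => (hw x).mono ?_, hj⟩
      have : m x ≤ n := hm ▸ Finset.single_le_sum (fun _ _ => Nat.zero_le _) (Finset.mem_univ x)
      omega
    · cases h with
      | base k => omega
      | @step n g i l t h =>
        cases h with
        | base k => omega
        | @step n g i u s h =>
          by_cases hs : s = 0
          · subst hs
            have h2 := Word.step (u + l) t h
            rw [B_add, ← mul_assoc] at h2
            obtain ⟨j, hw, hj⟩ := ih _ (by omega) h2
            rw [A_zero, mul_one]
            exact ⟨j, fun x => (hw x).mono (by omega), by rw [hj]; ring⟩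
          · obtain ⟨j, hw, hj⟩ := ih n (by omega) h
            refine ⟨fun x => j (x + t + s) + (if x + t + s = -1 then u else 0) +
              if x + t = -1 then l else 0, fun x => ?_, ?_⟩
            · rw [sec_mul_B_mul_A, sec_mul_B_mul_A]
              refine (((hw _).mul (word_sec_B _ _)).mul (word_sec_B _ _)).mono ?_
              have : ¬ (x + t + s = -1 ∧ x + t = -1) := by
                rintro ⟨h1, h2⟩
                rw [h2] at h1
                exact hs (by simpa using h1)
              split_ifs <;> first | omega | (exfalso; tauto)
            · rw [sum_shift fun x => j (x + s) + (if x + s = -1 then u else 0) +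
                if x = -1 then l else 0, Finset.sum_add_distrib,
                sum_shift fun x => j x + if x = -1 then u else 0, Finset.sum_add_distrib, hj]
              simp

theorem exists_E_ne_zero (D : GGSData p E G) : ∃ x, x ≠ -1 ∧ E x ≠ 0 := by
  obtain ⟨x, hx⟩ := Function.ne_iff.1 D.E_ne_zero
  exact ⟨x, fun h => hx (by rw [h, D.E_neg_one]; rfl), hx⟩

/-- This makes the exponent sum well defined. The sections of `1` are `1`, written with about half
as many powers of `b`, and their exponent sums add up to `i`; so length at most one remains, where
`b ^ i = 1` is refuted for `i ≠ 0` at a letter with nonzero entry. -/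
theorem Word.exponent_eq_zero {n : ℕ} {i : ZMod p} (h : D.Word n 1 i) : i = 0 := by
  induction n using Nat.strong_induction_on generalizing i with
  | _ n ih =>
    by_cases hn : n < 2
    · obtain ⟨k, l, hkl⟩ := (h.mono (show n ≤ 1 by omega)).one
      have h1 : D.act 1 = k + l := by rw [hkl, act_mul, act_mul]; simp
      rw [act_one] at h1
      have h2 : D.B i = 1 := by
        have : D.B i = (D.A k)⁻¹ * (D.A k * D.B i * D.A l) * (D.A l)⁻¹ := by group
        rw [this, ← hkl, mul_one, ← A_neg, ← A_neg, ← A_add, ← neg_add, ← h1]; simp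
      obtain ⟨x, hx, hE⟩ := D.exists_E_ne_zero
      have h3 := D.sec_B i x
      rw [h2, sec_one, if_neg hx] at h3
      have h4 := congrArg D.act h3
      rw [act_one, act_A] at h4
      exact (mul_eq_zero.1 h4.symm).resolve_left hE
    · obtain ⟨j, hw, hj⟩ := h.sections_half
      rw [← hj]
      refine Finset.sum_eq_zero fun x _ => ih ((n + 1) / 2) (by omega) ?_
      have := hw x
      rwa [sec_one] at this

theorem Word.exponent_unique {m n : ℕ} {g : G} {i j : ZMod p} (h : D.Word m g i)
    (h' : D.Word n g j) : i = j := by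
  have := h.mul h'.inv
  rw [mul_inv_cancel, ← sub_eq_add_neg] at this
  exact sub_eq_zero.1 this.exponent_eq_zero

variable (D)

/-- The exponent sum of `b`. -/
noncomputable def beta (g : G) : ZMod p := (D.exists_word g).choose_spec.choose

theorem exists_word_beta (g : G) : ∃ n, D.Word n g (D.beta g) :=
  ⟨_, (D.exists_word g).choose_spec.choose_spec⟩

variable {D} in
theorem Word.beta_eq {n : ℕ} {g : G} {i : ZMod p} (h : D.Word n g i) : D.beta g = i :=
  (D.exists_word_beta g).choose_spec.exponent_unique h

open Classical in
/-- The least number of powers of `b` in an expression of `g`. -/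
noncomputable def len (g : G) : ℕ := Nat.find (D.exists_word_beta g)

theorem word_len (g : G) : D.Word (D.len g) g (D.beta g) := by
  classical
  exact Nat.find_spec (D.exists_word_beta g)

variable {D} in
theorem Word.len_le {n : ℕ} {g : G} {i : ZMod p} (h : D.Word n g i) : D.len g ≤ n := by
  classical
  exact Nat.find_min' _ (h.beta_eq ▸ h)

theorem beta_mul (g h : G) : D.beta (g * h) = D.beta g + D.beta h :=
  ((D.word_len g).mul (D.word_len h)).beta_eq

theorem beta_inv (g : G) : D.beta g⁻¹ = -D.beta g := (D.word_len g).inv.beta_eq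

theorem beta_conj (g h : G) : D.beta (g * h * g⁻¹) = D.beta h := by
  rw [beta_mul, beta_mul, beta_inv]; ring

@[simp] theorem beta_A (k : ZMod p) : D.beta (D.A k) = 0 := (Word.base k).beta_eq

@[simp] theorem beta_B (k : ZMod p) : D.beta (D.B k) = k := (Word.of_B k).beta_eq

theorem beta_one : D.beta 1 = 0 := by rw [← D.A_zero, beta_A]

theorem beta_pow (g : G) (n : ℕ) : D.beta (g ^ n) = n * D.beta g := by
  induction n with
  | zero => simp [beta_one]
  | succ n ih => rw [pow_succ, beta_mul, ih]; push_cast; ring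

theorem sum_beta_sec (g : G) : ∑ x, D.beta (D.sec g x) = D.beta g := by
  obtain ⟨m, j, hw, -, hj⟩ := (D.word_len g).sections
  rw [← hj]
  exact Finset.sum_congr rfl fun x _ => (hw x).beta_eq

theorem len_mul (g h : G) : D.len (g * h) ≤ D.len g + D.len h :=
  ((D.word_len g).mul (D.word_len h)).len_le

theorem len_inv (g : G) : D.len g⁻¹ = D.len g := by
  have h : ∀ g, D.len g⁻¹ ≤ D.len g := fun g => (D.word_len g).inv.len_le
  refine le_antisymm (h g) ?_
  simpa using h g⁻¹

@[simp] theorem len_A (k : ZMod p) : D.len (D.A k) = 0 := Nat.le_zero.1 (Word.base k).len_le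

@[simp] theorem len_one : D.len 1 = 0 := by rw [← D.A_zero, len_A]

theorem len_B (k : ZMod p) : D.len (D.B k) ≤ 1 := (Word.of_B k).len_le

theorem exists_eq_A {g : G} (h : D.len g = 0) : g = D.A (D.act g) := by
  obtain ⟨k, rfl⟩ := Word.zero (h ▸ D.word_len g)
  simp

theorem exists_eq_A_B_A {g : G} (h : D.len g ≤ 1) : ∃ k l, g = D.A k * D.B (D.beta g) * D.A l :=
  ((D.word_len g).mono h).one

theorem exists_eq_conj_B {g : G} (h : D.len g ≤ 1) (h0 : D.act g = 0) :
    ∃ k, g = D.A k * D.B (D.beta g) * (D.A k)⁻¹ := by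
  obtain ⟨k, l, hkl⟩ := D.exists_eq_A_B_A h
  have h1 : k + l = 0 := by
    rw [hkl, act_mul, act_mul] at h0
    simpa using h0
  refine ⟨k, ?_⟩
  rw [← A_neg, neg_eq_of_add_eq_zero_right h1]
  exact hkl

theorem sum_len_sec (g : G) : ∑ x, D.len (D.sec g x) ≤ D.len g := by
  obtain ⟨m, j, hw, hm, -⟩ := (D.word_len g).sections
  rw [← hm]
  exact Finset.sum_le_sum fun x _ => (hw x).len_le

theorem len_sec_le (g : G) (x : ZMod p) : D.len (D.sec g x) ≤ (D.len g + 1) / 2 := by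
  obtain ⟨j, hw, -⟩ := (D.word_len g).sections_half
  exact (hw x).len_le

/-! ### The actions of the sections -/

/-- A power `b ^ j` in a word adds `j` to the exponent sum of the section at one letter `k`, and the
section at any other `x` receives the power of `a` prescribed by the letter `x - k - 1`. At `x = k`
this letter is `-1`, where `E` vanishes. The actions are thus the convolution of the exponent sums
with `E (· - 1)`. -/
theorem act_sec (g : G) (x : ZMod p) :
    D.act (D.sec g x) = ∑ k, E (x - k - 1) * D.beta (D.sec g k) := by
  have key : ∀ n g i, D.Word n g i → ∀ x,
      D.act (D.sec g x) = ∑ k, E (x - k - 1) * D.beta (D.sec g k) := by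
    intro n g i h
    induction h with
    | base k => intro x; simp [act_one, beta_one]
    | @step n g i j k h ih =>
      intro x
      simp only [sec_mul_B_mul_A, act_mul, beta_mul, mul_add, Finset.sum_add_distrib]
      rw [ih]
      congr 1
      · rw [← sum_shift (fun y => E (x + k - y - 1) * D.beta (D.sec g y)) k]
        refine Finset.sum_congr rfl fun y _ => ?_
        congr 2
        ring
      · rw [Finset.sum_eq_single (-1 - k)]
        · have : x - (-1 - k) - 1 = x + k := by ring
          rw [this, sub_add_cancel, sec_B, sec_B, if_pos rfl, beta_B]
          split_ifs with hx
          · rw [hx, D.E_neg_one]; simp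
          · simp
        · intro y _ hy
          rw [sec_B, if_neg fun h => hy (eq_sub_of_add_eq h)]
          simp
        · simp
  exact key _ g _ (D.word_len g) x

end GGSData

/-! ### Convolution on the cyclic group of order `p` -/

section Convolution

variable {p : ℕ} [hp : Fact p.Prime]

/-- A function on the cyclic group as an element of the group algebra. -/
noncomputable def toAlg (f : ZMod p → ZMod p) : AddMonoidAlgebra (ZMod p) (ZMod p) :=
  ∑ x, AddMonoidAlgebra.single x (f x)

theorem toAlg_injective : Function.Injective (toAlg (p := p)) := by
  intro f g h
  funext x
  have key : ∀ f : ZMod p → ZMod p, (toAlg f).coeff x = f x := fun f => by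
    classical
    simp [toAlg, Finsupp.single_apply]
  rw [← key f, h, key g]

theorem toAlg_mul (f g : ZMod p → ZMod p) :
    toAlg f * toAlg g = toAlg fun x => ∑ k, f (x - k) * g k := by
  have key : ∀ k, ∑ x, AddMonoidAlgebra.single (x + k) (f x * g k) =
      ∑ x, AddMonoidAlgebra.single x (f (x - k) * g k) := fun k => by
    rw [← GGSData.sum_shift (fun x => AddMonoidAlgebra.single x (f (x - k) * g k)) k]
    simp
  simp only [toAlg, Finset.sum_mul_sum, AddMonoidAlgebra.single_mul_single]
  rw [Finset.sum_comm]
  simp only [key]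
  rw [Finset.sum_comm]
  refine Finset.sum_congr rfl fun x _ => ?_
  exact (map_sum (AddMonoidAlgebra.singleAddHom x) _ _).symm

/-- Frobenius is additive in characteristic `p`, and `p` kills the cyclic group, so only the
augmentation survives. -/
theorem toAlg_pow (f : ZMod p → ZMod p) :
    toAlg f ^ p = AddMonoidAlgebra.single 0 (∑ x, f x) := by
  have : CharP (AddMonoidAlgebra (ZMod p) (ZMod p)) p :=
    charP_of_injective_algebraMap
      (algebraMap (ZMod p) (AddMonoidAlgebra (ZMod p) (ZMod p))).injective p
  rw [toAlg, sum_pow_char]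
  simp only [AddMonoidAlgebra.single_pow, ZMod.pow_card, CharP.cast_eq_zero, nsmul_eq_mul, zero_mul]
  exact (map_sum (AddMonoidAlgebra.singleAddHom 0) _ _).symm

theorem toAlg_smul (c : ZMod p) (f : ZMod p → ZMod p) :
    AddMonoidAlgebra.single 0 c * toAlg f = toAlg fun x => c * f x := by
  simp [toAlg, Finset.mul_sum, AddMonoidAlgebra.single_mul_single]

theorem toAlg_zero : toAlg (0 : ZMod p → ZMod p) = 0 := by simp [toAlg]

/-- A convolution operator of augmentation `0` has no nonzero eigenvalue. -/
theorem eq_zero_of_conv_eq_smul {f u : ZMod p → ZMod p} (hf : ∑ x, f x = 0) {c : ZMod p}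
    (hc : c ≠ 0) (h : ∀ x, ∑ k, f (x - k) * u k = c * u x) : u = 0 := by
  have h1 : toAlg f * toAlg u = AddMonoidAlgebra.single 0 c * toAlg u := by
    rw [toAlg_mul, toAlg_smul]
    exact congrArg toAlg (funext h)
  have h2 : ∀ n : ℕ, toAlg f ^ n * toAlg u = AddMonoidAlgebra.single 0 (c ^ n) * toAlg u := by
    intro n
    induction n with
    | zero => simp [← AddMonoidAlgebra.one_def]
    | succ n ih =>
      rw [pow_succ, mul_assoc, h1, mul_left_comm, ih, ← mul_assoc,
        AddMonoidAlgebra.single_mul_single, zero_add, pow_succ']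
  -- The `p`-th power of `f` is its augmentation `0`, whereas `c ^ p = c`.
  have h3 := h2 p
  rw [toAlg_pow, hf, ZMod.pow_card, toAlg_smul, toAlg_smul] at h3
  funext x
  have h4 := congrFun (toAlg_injective h3) x
  rw [zero_mul] at h4
  exact (mul_eq_zero.1 h4.symm).resolve_left hc

/-- An element of nonzero augmentation is not a zero divisor. -/
theorem eq_zero_of_conv_eq_zero {f u : ZMod p → ZMod p} (hu : ∑ x, u x ≠ 0)
    (h : ∀ x, ∑ k, f (x - k) * u k = 0) : f = 0 := by
  have h1 : toAlg f * toAlg u = 0 := by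
    rw [toAlg_mul, ← toAlg_zero]
    exact congrArg toAlg (funext h)
  have h2 : toAlg f * toAlg u ^ p = 0 := by
    rw [← mul_pow_sub_one hp.out.ne_zero, ← mul_assoc, h1, zero_mul]
  rw [toAlg_pow, mul_comm, toAlg_smul, ← toAlg_zero] at h2
  funext x
  exact (mul_eq_zero.1 (congrFun (toAlg_injective h2) x)).resolve_left hu

end Convolution

namespace GGSData

variable {p : ℕ} [hp : Fact p.Prime] {E : ZMod p → ZMod p} {G : Type*} [Group G]
  (D : GGSData p E G)

/-! ### Consequences of the convolution formula. -/

theorem sum_act_sec (g : G) : ∑ x, D.act (D.sec g x) = (∑ x, E x) * D.beta g := by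
  simp only [act_sec]
  rw [Finset.sum_comm, ← sum_beta_sec, Finset.mul_sum]
  refine Finset.sum_congr rfl fun k _ => ?_
  rw [← Finset.sum_mul]
  congr 1
  rw [← sum_shift E (-k - 1)]
  refine Finset.sum_congr rfl fun x _ => ?_
  congr 1
  ring

/-- If all sections of `g` act proportionally to their exponent sums, both vanish. -/
theorem beta_sec_eq_zero (hE : ∑ x, E x = 0) {g : G} {c : ZMod p} (hc : c ≠ 0)
    (h : ∀ x, D.act (D.sec g x) = c * D.beta (D.sec g x)) (x : ZMod p) :
    D.beta (D.sec g x) = 0 := by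
  have h1 : ∑ x, E (x - 1) = 0 := by
    rw [← hE, ← sum_shift E (-1)]
    simp only [sub_eq_add_neg]
  refine congrFun (eq_zero_of_conv_eq_smul (f := fun x => E (x - 1))
    (u := fun x => D.beta (D.sec g x)) h1 hc fun x => ?_) x
  rw [← h, act_sec]

/-- The exponent sums of the sections have nonzero total, so as an element of the group algebra they
do not annihilate the nonzero vector `E`. -/
theorem exists_act_sec_ne_zero {g : G} (h : D.beta g ≠ 0) : ∃ x, D.act (D.sec g x) ≠ 0 := by
  by_contra! hcon
  have h1 : (fun x => E (x - 1)) = 0 := by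
    refine eq_zero_of_conv_eq_zero (u := fun x => D.beta (D.sec g x))
      (by rw [sum_beta_sec]; exact h) fun x => ?_
    rw [← hcon x, act_sec]
  apply D.E_ne_zero
  funext x
  have := congrFun h1 (x + 1)
  simpa using this

/-! ### Sections of powers -/

theorem sec_pow (g : G) (n : ℕ) (x : ZMod p) :
    D.sec (g ^ (n + 1)) x = D.sec g (x + n * D.act g) * D.sec (g ^ n) x := by
  rw [pow_succ', sec_mul, act_pow]

/-- A sum over the orbit of a nontrivial translation is the sum over all letters. -/
theorem sum_range_translate {M : Type*} [AddCommMonoid M] (f : ZMod p → M) (x : ZMod p)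
    {k : ZMod p} (hk : k ≠ 0) : ∑ n ∈ Finset.range p, f (x + n * k) = ∑ y, f y := by
  refine Finset.sum_nbij (fun n : ℕ => x + n * k) (by simp) ?_ ?_ (by simp)
  · intro m hm n hn hmn
    have h1 : (m : ZMod p) = n := mul_right_cancel₀ hk (add_left_cancel hmn)
    have h2 := congrArg ZMod.val h1
    rwa [ZMod.val_cast_of_lt (by simpa using hm), ZMod.val_cast_of_lt (by simpa using hn)] at h2
  · intro y _
    refine ⟨((y - x) / k).val, by simpa using ZMod.val_lt _, ?_⟩
    simp [div_mul_cancel₀ _ hk]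

theorem act_sec_pow (g : G) (n : ℕ) (x : ZMod p) :
    D.act (D.sec (g ^ n) x) = ∑ i ∈ Finset.range n, D.act (D.sec g (x + i * D.act g)) := by
  induction n with
  | zero => simp [sec_one, act_one]
  | succ n ih => rw [sec_pow, act_mul, ih, Finset.sum_range_succ, add_comm]

theorem beta_sec_pow (g : G) (n : ℕ) (x : ZMod p) :
    D.beta (D.sec (g ^ n) x) = ∑ i ∈ Finset.range n, D.beta (D.sec g (x + i * D.act g)) := by
  induction n with
  | zero => simp [sec_one, beta_one]
  | succ n ih => rw [sec_pow, beta_mul, ih, Finset.sum_range_succ, add_comm]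

theorem len_sec_pow (g : G) (n : ℕ) (x : ZMod p) :
    D.len (D.sec (g ^ n) x) ≤ ∑ i ∈ Finset.range n, D.len (D.sec g (x + i * D.act g)) := by
  induction n with
  | zero => simp [sec_one]
  | succ n ih =>
    rw [sec_pow, Finset.sum_range_succ]
    have := D.len_mul (D.sec g (x + n * D.act g)) (D.sec (g ^ n) x)
    omega

theorem act_pow_p (g : G) : D.act (g ^ p) = 0 := by rw [act_pow]; simp

/-- A nontrivial translation has a single orbit because `p` is prime, so a section of `g ^ p` is the
product of all first-level sections of `g` in orbit order. -/
theorem act_sec_pow_p {g : G} (hg : D.act g ≠ 0) (x : ZMod p) :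
    D.act (D.sec (g ^ p) x) = (∑ x, E x) * D.beta g := by
  rw [act_sec_pow, sum_range_translate (fun y => D.act (D.sec g y)) x hg, sum_act_sec]

theorem beta_sec_pow_p {g : G} (hg : D.act g ≠ 0) (x : ZMod p) :
    D.beta (D.sec (g ^ p) x) = D.beta g := by
  rw [beta_sec_pow, sum_range_translate (fun y => D.beta (D.sec g y)) x hg, sum_beta_sec]

theorem len_sec_pow_p {g : G} (hg : D.act g ≠ 0) (x : ZMod p) :
    D.len (D.sec (g ^ p) x) ≤ D.len g := by
  refine (D.len_sec_pow g p x).trans ?_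
  rw [sum_range_translate (fun y => D.len (D.sec g y)) x hg]
  exact D.sum_len_sec g

/-- If the group is torsion, the defining vector has sum zero. -/
theorem sum_E_eq_zero (D : GGSData p E G) (ht : IsMulTorsion G) : ∑ x, E x = 0 := by
  by_contra hs
  set σ := ∑ x, E x with hσ
  -- If `σ ≠ 0`, a section of `g ^ p` again acts by `σ`, has exponent sum `1` and length at most
  -- one. It is thus conjugate to `g`, and the order of `g` could be divided by `p` indefinitely.
  set g := D.A σ * D.b with hg
  have hact : D.act g = σ := by rw [hg, act_mul, act_A, act_b, add_zero]
  have hb : D.beta g = 1 := by rw [hg, ← B_one, beta_mul, beta_A, beta_B, zero_add]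
  have hlen : D.len g ≤ 1 := by
    refine (D.len_mul _ _).trans ?_
    rw [len_A, ← B_one]
    have := D.len_B 1
    omega
  have hne : D.act g ≠ 0 := by rwa [hact]
  set z := D.sec (g ^ p) 0 with hz
  have hz1 : D.act z = σ := by rw [hz, D.act_sec_pow_p hne, hb, mul_one]
  have hz2 : D.beta z = 1 := by rw [hz, D.beta_sec_pow_p hne, hb]
  obtain ⟨k, l, hkl⟩ := D.exists_eq_A_B_A ((D.len_sec_pow_p hne 0).trans hlen)
  rw [← hz, hz2, B_one] at hkl
  have hkl2 : l + k = σ := by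
    rw [← hz1, hkl, act_mul, act_mul, act_A, act_A, act_b]; ring
  have hconj : D.A l * z * (D.A l)⁻¹ = g := by
    rw [hg, ← hkl2, A_add, hkl]; group
  have hpos : 0 < orderOf g := (ht g).orderOf_pos
  have h1 : g ^ orderOf g = 1 := pow_orderOf_eq_one g
  have h2 : p ∣ orderOf g := by
    have := congrArg D.act h1
    rw [act_pow, act_one] at this
    exact (ZMod.natCast_eq_zero_iff _ _).1 ((mul_eq_zero.1 this).resolve_right hne)
  obtain ⟨m, hm⟩ := h2
  have h3 : z ^ m = 1 := by
    rw [hz, ← D.sec_pow_of_act (D.act_pow_p g), ← pow_mul, ← hm, h1, sec_one]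
  have h4 : g ^ m = 1 := by rw [← hconj, conj_pow, h3]; group
  have h5 := Nat.le_of_dvd (Nat.pos_of_ne_zero (by rintro rfl; omega)) (orderOf_dvd_of_pow_eq_one h4)
  have h6 := hp.out.one_lt
  nlinarith

/-! ### Sections of subgroups -/

/-- The section of a subgroup at a letter. -/
def secSub (H : Subgroup G) (x : ZMod p) : Subgroup G := (H.subgroupOf D.St).map (D.secHom x)

theorem mem_secSub {H : Subgroup G} {x : ZMod p} {g : G} :
    g ∈ D.secSub H x ↔ ∃ h ∈ H, D.act h = 0 ∧ D.sec h x = g := by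
  constructor
  · rintro ⟨h, hh, rfl⟩
    exact ⟨h, hh, h.2, rfl⟩
  · rintro ⟨h, hh, h0, rfl⟩
    exact ⟨⟨h, h0⟩, hh, rfl⟩

theorem sec_mem_secSub {H : Subgroup G} {h : G} (hh : h ∈ H) (h0 : D.act h = 0) (x : ZMod p) :
    D.sec h x ∈ D.secSub H x := D.mem_secSub.2 ⟨h, hh, h0, rfl⟩

/-- The conjugate `g H g⁻¹`. -/
def conj (g : G) (H : Subgroup G) : Subgroup G := H.map (MulAut.conj g).toMonoidHom

theorem conj_mem_conj {g h : G} {H : Subgroup G} (hh : h ∈ H) : g * h * g⁻¹ ∈ conj g H :=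
  ⟨h, hh, rfl⟩

theorem mem_conj {g h : G} {H : Subgroup G} : h ∈ conj g H ↔ g⁻¹ * h * g ∈ H := by
  constructor
  · rintro ⟨k, hk, rfl⟩
    simpa [mul_assoc] using hk
  · intro hh
    exact ⟨_, hh, by simp [mul_assoc]⟩

theorem conj_conj (g h : G) (H : Subgroup G) : conj g (conj h H) = conj (g * h) H := by
  ext k
  simp only [mem_conj, mul_inv_rev, mul_assoc]

theorem conj_one (H : Subgroup G) : conj 1 H = H := by
  ext k
  simp [mem_conj]

theorem conj_eq_self {g : G} {H : Subgroup G} (hg : g ∈ H) : conj g H = H := by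
  ext k
  rw [mem_conj]
  constructor
  · intro h
    simpa [mul_assoc] using H.mul_mem (H.mul_mem hg h) (H.inv_mem hg)
  · intro h
    exact H.mul_mem (H.mul_mem (H.inv_mem hg) h) hg

theorem secSub_conj_le (g : G) (H : Subgroup G) (x : ZMod p) :
    conj (D.sec g x) (D.secSub H x) ≤ D.secSub (conj g H) (x + D.act g) := by
  rintro _ ⟨k, hk, rfl⟩
  obtain ⟨h, hh, h0, rfl⟩ := D.mem_secSub.1 hk
  refine D.mem_secSub.2 ⟨g * h * g⁻¹, conj_mem_conj hh, by rw [act_conj, h0], ?_⟩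
  rw [sec_conj, h0, add_zero]
  rfl

theorem secSub_conj (g : G) (H : Subgroup G) (x : ZMod p) :
    D.secSub (conj g H) (x + D.act g) = conj (D.sec g x) (D.secSub H x) := by
  refine le_antisymm ?_ (D.secSub_conj_le g H x)
  have h := D.secSub_conj_le g⁻¹ (conj g H) (x + D.act g)
  rw [conj_conj, inv_mul_cancel, conj_one, act_inv, add_neg_cancel_right, sec_inv,
    add_sub_cancel_right] at h
  intro k hk
  rw [mem_conj]
  apply h
  simpa using conj_mem_conj (g := (D.sec g x)⁻¹) hk

theorem secSub_translate {H : Subgroup G} {h : G} (hh : h ∈ H) (x : ZMod p) :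
    D.secSub H (x + D.act h) = conj (D.sec h x) (D.secSub H x) := by
  conv_lhs => rw [← conj_eq_self hh]
  exact D.secSub_conj h H x

theorem exists_mem_act_eq {H : Subgroup G} {h : G} (hh : h ∈ H) (h0 : D.act h ≠ 0)
    (y : ZMod p) : ∃ k ∈ H, D.act k = y := by
  refine ⟨h ^ (y / D.act h).val, pow_mem hh _, ?_⟩
  rw [act_pow, ZMod.natCast_zmod_val, div_mul_cancel₀ _ h0]

theorem exists_secSub_eq_conj {H : Subgroup G} {h : G} (hh : h ∈ H) (h0 : D.act h ≠ 0)
    (x y : ZMod p) : ∃ t, D.secSub H y = conj t (D.secSub H x) := by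
  obtain ⟨k, hk, hky⟩ := D.exists_mem_act_eq hh h0 (y - x)
  refine ⟨D.sec k x, ?_⟩
  rw [← D.secSub_translate hk, hky, add_sub_cancel]

/-! ### Tame subgroups -/

/-- A subgroup is tame if after finitely many levels its sections are finite or everything. -/
inductive Tame : Subgroup G → Prop
  | top : Tame ⊤
  | of_finite (H : Subgroup G) (h : Finite H) : Tame H
  | of_sections (H : Subgroup G) (h : ∀ x, Tame (D.secSub H x)) : Tame H

variable {D}

theorem Tame.conj {H : Subgroup G} (hH : D.Tame H) (g : G) : D.Tame (conj g H) := by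
  induction hH generalizing g with
  | top =>
    have : GGSData.conj g (⊤ : Subgroup G) = ⊤ := by
      ext k; simp [mem_conj]
    rw [this]
    exact Tame.top
  | of_finite H h =>
    refine Tame.of_finite _ ?_
    exact Finite.of_surjective _ (MonoidHom.subgroupMap_surjective _ H)
  | of_sections H _ ih =>
    refine Tame.of_sections _ fun x => ?_
    have := D.secSub_conj g H (x - D.act g)
    rw [sub_add_cancel] at this
    rw [this]
    exact ih _ _

theorem Tame.of_conj {H : Subgroup G} (g : G) (hH : D.Tame (GGSData.conj g H)) : D.Tame H := by
  have := hH.conj g⁻¹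
  rwa [conj_conj, inv_mul_cancel, conj_one] at this

/-- All first-level sections are conjugate, so a single one decides. -/
theorem Tame.of_transitive {H : Subgroup G} {h : G} (hh : h ∈ H) (h0 : D.act h ≠ 0) {x : ZMod p}
    (hx : D.Tame (D.secSub H x)) : D.Tame H := by
  refine Tame.of_sections _ fun y => ?_
  obtain ⟨t, ht⟩ := D.exists_secSub_eq_conj hh h0 x y
  rw [ht]
  exact hx.conj t

variable (D)

/-! ### Dense subgroups -/

/-- A subgroup is dense if it surjects onto the abelianisation. -/
def Dense (H : Subgroup G) : Prop :=
  (∃ g ∈ H, D.act g ≠ 0) ∧ ∃ g ∈ H, D.act g = 0 ∧ D.beta g ≠ 0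

/-- If both alternatives fail, the exponent sum is a fixed multiple `c` of the action on the
section. As the sections at all letters are conjugate, this holds for every section of an element of
`H` fixing the first level. The exponent sums are then zero or an eigenvector for `c⁻¹` of a
nilpotent convolution; either way they vanish, and with them the actions. -/
theorem dense_or_le_St (hE : ∑ x, E x = 0) {H : Subgroup G} {h : G} (hh : h ∈ H)
    (h0 : D.act h ≠ 0) (x : ZMod p) : D.Dense (D.secSub H x) ∨ D.secSub H x ≤ D.St := by
  by_contra! hcon
  obtain ⟨hd, hle⟩ := hcon
  obtain ⟨k, hk, hk0⟩ := SetLike.not_le_iff_exists.1 hle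
  rw [mem_St] at hk0
  have h1 : ∀ g ∈ D.secSub H x, D.act g = 0 → D.beta g = 0 := fun g hg hg0 => by
    by_contra hb
    exact hd ⟨⟨k, hk, hk0⟩, g, hg, hg0, hb⟩
  set c := D.beta k / D.act k with hc
  have h2 : ∀ g ∈ D.secSub H x, D.beta g = c * D.act g := fun g hg => by
    have h3 := h1 (g * (k ^ (D.act g / D.act k).val)⁻¹) (mul_mem hg (inv_mem (pow_mem hk _))) (by
      rw [act_mul, act_inv, act_pow, ZMod.natCast_zmod_val, div_mul_cancel₀ _ hk0, add_neg_cancel])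
    rw [beta_mul, beta_inv, beta_pow, ZMod.natCast_zmod_val, ← sub_eq_add_neg, sub_eq_zero] at h3
    rw [h3, hc]
    ring
  have h4 : ∀ y ∈ H, D.act y = 0 → ∀ z, D.beta (D.sec y z) = c * D.act (D.sec y z) := by
    intro y hy hy0 z
    obtain ⟨t, ht⟩ := D.exists_secSub_eq_conj hh h0 z x
    have h5 := h2 (t * D.sec y z * t⁻¹) (ht ▸ conj_mem_conj (D.sec_mem_secSub hy hy0 z))
    rwa [beta_conj, act_conj] at h5
  obtain ⟨y, hy, hy0, rfl⟩ := D.mem_secSub.1 hk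
  have h5 : ∀ z, D.beta (D.sec y z) = 0 := by
    by_cases hc0 : c = 0
    · intro z
      rw [h4 y hy hy0, hc0, zero_mul]
    · refine D.beta_sec_eq_zero hE (inv_ne_zero hc0) fun z => ?_
      rw [h4 y hy hy0, inv_mul_cancel_left₀ hc0]
  apply hk0
  rw [act_sec]
  exact Finset.sum_eq_zero fun z _ => by rw [h5, mul_zero]

variable {D}

/-- An element fixing the first level with nonzero exponent sum has a section moving the first
level, which excludes the second alternative of `dense_or_le_St`. -/
theorem Dense.secSub (hE : ∑ x, E x = 0) {H : Subgroup G} (hH : D.Dense H) (x : ZMod p) :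
    D.Dense (D.secSub H x) := by
  obtain ⟨⟨h, hh, h0⟩, y, hy, hy0, hyb⟩ := hH
  refine (D.dense_or_le_St hE hh h0 x).resolve_right fun hle => ?_
  obtain ⟨z, hz⟩ := D.exists_act_sec_ne_zero hyb
  obtain ⟨t, ht⟩ := D.exists_secSub_eq_conj hh h0 z x
  have h5 := hle (ht ▸ conj_mem_conj (D.sec_mem_secSub hy hy0 z))
  rw [mem_St, act_conj] at h5
  exact hz h5

/-! ### Tameness of dense subgroups. -/

theorem exists_two_E_ne_zero (D : GGSData p E G) (hE : ∑ x, E x = 0) :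
    ∃ i j, i ≠ j ∧ i ≠ -1 ∧ j ≠ -1 ∧ E i ≠ 0 ∧ E j ≠ 0 := by
  obtain ⟨i, hi, hEi⟩ := D.exists_E_ne_zero
  by_contra! hcon
  apply hEi
  rw [← hE, eq_comm]
  refine Finset.sum_eq_single i (fun j _ hj => ?_) (by simp)
  by_cases hj1 : j = -1
  · rw [hj1, D.E_neg_one]
  · exact hcon i j hj.symm hi hj1 hEi

/-- The three lengths add up to at most `D.len s`. If both inequalities failed, the whole length
would sit at `-1`, where only about half of it fits. -/
theorem exists_len_sec_add_lt {s : G} (hs : 2 ≤ D.len s) {i j : ZMod p} (hij : i ≠ j)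
    (hi : i ≠ -1) (hj : j ≠ -1) :
    D.len (D.sec s i) + D.len (D.sec s (-1)) < D.len s ∨
      D.len (D.sec s j) + D.len (D.sec s (-1)) < D.len s := by
  have h1 : D.len (D.sec s i) + (D.len (D.sec s j) + D.len (D.sec s (-1))) ≤ D.len s := by
    refine le_trans ?_ (D.sum_len_sec s)
    have h2 : ∑ x ∈ ({i, j, -1} : Finset (ZMod p)), D.len (D.sec s x) ≤
        ∑ x, D.len (D.sec s x) :=
      Finset.sum_le_sum_of_subset (Finset.subset_univ _)
    rwa [Finset.sum_insert (by simp [hij, hi]), Finset.sum_insert (by simp [hj]),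
      Finset.sum_singleton] at h2
  have h3 := D.len_sec_le s (-1)
  omega

theorem len_sec_add_le (s : G) {i : ZMod p} (hi : i ≠ -1) :
    D.len (D.sec s i) + D.len (D.sec s (-1)) ≤ D.len s := by
  refine le_trans ?_ (D.sum_len_sec s)
  have h2 : ∑ x ∈ ({i, -1} : Finset (ZMod p)), D.len (D.sec s x) ≤ ∑ x, D.len (D.sec s x) :=
    Finset.sum_le_sum_of_subset (Finset.subset_univ _)
  rwa [Finset.sum_insert (by simp [hi]), Finset.sum_singleton] at h2

theorem conj_a_mem_of_conj_A_mem {H : Subgroup G} {k : ZMod p} (hk : k ≠ 0) {t : G}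
    (h : t * D.A k * t⁻¹ ∈ H) : t * D.a * t⁻¹ ∈ H := by
  have h1 : D.A k ∈ conj t⁻¹ H := by rw [mem_conj]; simpa using h
  have h2 := D.a_mem_of_A_mem hk h1
  rw [mem_conj] at h2
  simpa using h2

/-- If the tameness of the subgroups containing `b` and a conjugate of `a` by an element of length
at most `n` is known, so is that of the subgroups containing `a` and a conjugate of `b`. -/
theorem tame_of_a_mem {n : ℕ}
    (ih : ∀ (s : G) (H : Subgroup G), D.len s ≤ n → D.b ∈ H → s * D.a * s⁻¹ ∈ H → D.Tame H)
    {t : G} {H : Subgroup G} (ht : D.len t ≤ n) (ha : D.a ∈ H) (hb : t * D.b * t⁻¹ ∈ H) :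
    D.Tame H := by
  wlog h0 : D.act t = 0 generalizing t
  · refine this (t := D.A (-D.act t) * t) ?_ ?_ (by rw [act_mul, act_A, neg_add_cancel])
    · refine (D.len_mul _ _).trans ?_
      rw [len_A, zero_add]
      exact ht
    · have hA : D.A (-D.act t) ∈ H := pow_mem ha _
      have := mul_mem (mul_mem hA hb) (inv_mem hA)
      simpa [mul_assoc] using this
  obtain ⟨i, hi, hEi⟩ := D.exists_E_ne_zero
  have hsec : ∀ x, D.sec t x * D.sec D.b x * (D.sec t x)⁻¹ ∈ D.secSub H x := fun x => by
    have h1 := D.sec_conj t D.b x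
    rw [h0, D.act_b, add_zero] at h1
    rw [← h1]
    exact D.sec_mem_secSub hb (by rw [act_conj, D.act_b]) x
  -- Powers of `a` have trivial sections, so the sections of `H` at all letters coincide. One
  -- section thus contains a conjugate of `b`, coming from `-1`, and a conjugate of `a`, coming from
  -- `i`.
  have heq : D.secSub H i = D.secSub H (-1) := by
    have h1 := D.secSub_translate (H := H) (h := D.A (i + 1)) (pow_mem ha _) (-1)
    rw [act_A, sec_A, conj_one] at h1
    rw [← h1]
    congr 1
    ring
  have h1 := hsec (-1)
  rw [sec_b, if_pos rfl] at h1
  have h2 := hsec i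
  rw [sec_b, if_neg hi, heq] at h2
  have h3 := conj_a_mem_of_conj_A_mem hEi h2
  refine Tame.of_transitive ha (by rw [D.act_a]; exact one_ne_zero) (x := -1)
    (Tame.of_conj (D.sec t (-1))⁻¹ (ih ((D.sec t (-1))⁻¹ * D.sec t i) _ ?_ ?_ ?_))
  · refine (D.len_mul _ _).trans ?_
    rw [len_inv, add_comm]
    exact (len_sec_add_le t hi).trans ht
  · rw [mem_conj]
    simpa using h1
  · rw [mem_conj]
    simpa [mul_assoc] using h3

/-- The section at `i` contains `a`, from `b` itself, and a conjugate of `b` carried over from `-1`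
by `s * a ^ (i + 1) * s⁻¹`. The conjugator is the quotient of the sections of `s` at `i` and `-1`.
-/
theorem tame_of_b_mem_of_len_lt {n : ℕ}
    (ih : ∀ (t : G) (H : Subgroup G), D.len t < n → D.a ∈ H → t * D.b * t⁻¹ ∈ H → D.Tame H)
    {s : G} {H : Subgroup G} (hb : D.b ∈ H) (ha : s * D.a * s⁻¹ ∈ H) (h0 : D.act s = 0)
    {i : ZMod p} (hi : i ≠ -1) (hEi : E i ≠ 0)
    (hlt : D.len (D.sec s i) + D.len (D.sec s (-1)) < n) : D.Tame H := by
  have hA : s * D.A (i + 1) * s⁻¹ ∈ H := by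
    rw [A, ← conj_pow]
    exact pow_mem ha _
  have h1 := D.secSub_translate hA (-1)
  have h2 := D.sec_conj s (D.A (i + 1)) (-1)
  have hi' : -1 + (i + 1) = i := by ring
  rw [h0, add_zero, act_A, sec_A, mul_one, hi'] at h2
  rw [act_conj, act_A, h2, hi'] at h1
  refine Tame.of_transitive ha (by rw [act_conj, D.act_a]; exact one_ne_zero) (x := i)
    (ih (D.sec s i * (D.sec s (-1))⁻¹) _ ?_ ?_ ?_)
  · have := D.len_mul (D.sec s i) (D.sec s (-1))⁻¹
    rw [len_inv] at this
    omega
  · have h3 := D.sec_mem_secSub hb D.act_b i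
    rw [sec_b, if_neg hi] at h3
    exact D.a_mem_of_A_mem hEi h3
  · rw [h1]
    have h3 := D.sec_mem_secSub hb D.act_b (-1)
    rw [sec_b, if_pos rfl] at h3
    exact conj_mem_conj h3

/-- Passing to a section exchanges the two situations. From `a` to `b` the conjugator does not get
longer; from `b` to `a` it gets strictly shorter, apart from cases of length at most one in which
`H` is the whole group. -/
theorem tame_of_a_mem_and_b_mem (hE : ∑ x, E x = 0) (n : ℕ) :
    (∀ (t : G) (H : Subgroup G), D.len t ≤ n → D.a ∈ H → t * D.b * t⁻¹ ∈ H → D.Tame H) ∧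
    ∀ (s : G) (H : Subgroup G), D.len s ≤ n → D.b ∈ H → s * D.a * s⁻¹ ∈ H → D.Tame H := by
  induction n using Nat.strong_induction_on with
  | _ n ih =>
    have key : ∀ (s : G) (H : Subgroup G), D.len s ≤ n → D.b ∈ H → s * D.a * s⁻¹ ∈ H →
        D.Tame H := by
      intro s H hs hb ha
      wlog h0 : D.act s = 0 generalizing s
      · refine this (s * D.A (-D.act s)) ?_ ?_ (by rw [act_mul, act_A, add_neg_cancel])
        · refine (D.len_mul _ _).trans ?_
          rw [len_A, add_zero]
          exact hs
        · have : s * D.A (-D.act s) * D.a * (s * D.A (-D.act s))⁻¹ = s * D.a * s⁻¹ := by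
            have hc : D.A (-D.act s) * D.a = D.a * D.A (-D.act s) :=
              ((Commute.refl D.a).pow_left _).eq
            rw [mul_assoc s, hc]
            group
          rwa [this]
      have ih' : ∀ (t : G) (H : Subgroup G), D.len t < n → D.a ∈ H → t * D.b * t⁻¹ ∈ H →
          D.Tame H := fun t H ht => (ih (D.len t) ht).1 t H le_rfl
      obtain ⟨i, j, hij, hi, hj, hEi, hEj⟩ := D.exists_two_E_ne_zero hE
      by_cases h2 : 2 ≤ D.len s
      · rcases exists_len_sec_add_lt h2 hij hi hj with h | h
        · exact tame_of_b_mem_of_len_lt ih' hb ha h0 hi hEi (h.trans_le hs)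
        · exact tame_of_b_mem_of_len_lt ih' hb ha h0 hj hEj (h.trans_le hs)
      · obtain ⟨k, hk⟩ := D.exists_eq_conj_B (show D.len s ≤ 1 by omega) h0
        have hsec : ∀ x, D.sec s x = D.sec (D.B (D.beta s)) (x - k) := fun x => by
          have h3 := D.sec_conj (D.A k) (D.B (D.beta s)) (x - k)
          rw [← hk, act_A, sec_A, sec_A, sub_add_cancel] at h3
          simpa using h3
        by_cases hk0 : k = 0
        · have h3 : s = D.B (D.beta s) := by
            rw [hk0] at hk
            simpa using hk
          have hB : s ∈ H := by rw [h3]; exact pow_mem hb _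
          have h4 : D.a ∈ H := by
            have := mul_mem (mul_mem (inv_mem hB) ha) hB
            simpa [mul_assoc] using this
          rw [D.eq_top_of_mem h4 hb]
          exact Tame.top
        by_cases hs0 : D.len s = 0
        · have h3 : s = 1 := by
            rw [D.exists_eq_A hs0, h0, A_zero]
          rw [h3] at ha
          rw [D.eq_top_of_mem (by simpa using ha) hb]
          exact Tame.top
        have hlen : ∀ x, x - k ≠ -1 → D.len (D.sec s x) = 0 := fun x hx => by
          rw [hsec, sec_B, if_neg hx, len_A]
        have hlast : D.len (D.sec s (-1)) = 0 := hlen _ fun h => hk0 (by simpa using h)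
        -- Only the section of `s` at `k - 1` can have positive length, and `i`, `j` cannot both be
        -- that letter.
        by_cases hik : i - k = -1
        · refine tame_of_b_mem_of_len_lt ih' hb ha h0 hj hEj ?_
          rw [hlast, hlen j fun h => hij (sub_left_injective (hik.trans h.symm))]
          omega
        · refine tame_of_b_mem_of_len_lt ih' hb ha h0 hi hEi ?_
          rw [hlast, hlen i hik]
          omega
    exact ⟨fun t H ht ha hb => tame_of_a_mem key ht ha hb, key⟩

/-- `b` puts `a` into the section at `i` and `b` into the section at `-1`, and these sections are
conjugate. -/
theorem Dense.tame_of_b_mem (hE : ∑ x, E x = 0) {H : Subgroup G} (hH : D.Dense H)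
    (hb : D.b ∈ H) : D.Tame H := by
  obtain ⟨⟨h, hh, h0⟩, -⟩ := hH
  obtain ⟨i, hi, hEi⟩ := D.exists_E_ne_zero
  obtain ⟨t, ht⟩ := D.exists_secSub_eq_conj hh h0 (-1) i
  refine Tame.of_transitive hh h0 (x := i)
    ((tame_of_a_mem_and_b_mem hE (D.len t)).1 t _ le_rfl ?_ ?_)
  · have h3 := D.sec_mem_secSub hb D.act_b i
    rw [sec_b, if_neg hi] at h3
    exact D.a_mem_of_A_mem hEi h3
  · rw [ht]
    have h3 := D.sec_mem_secSub hb D.act_b (-1)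
    rw [sec_b, if_pos rfl] at h3
    exact conj_mem_conj h3

/-- Dense subgroups are tame. -/
theorem Dense.tame (hE : ∑ x, E x = 0) {H : Subgroup G} (hH : D.Dense H) : D.Tame H := by
  obtain ⟨y, hy, hy0, hyb⟩ := hH.2
  induction hn : D.len y using Nat.strong_induction_on generalizing H y with
  | _ n ih =>
    obtain ⟨h, hh, h0⟩ := hH.1
    by_cases h1 : D.len y ≤ 1
    · obtain ⟨k, hk⟩ := D.exists_eq_conj_B h1 hy0
      refine Tame.of_transitive hh h0 (x := -1 + k) ((hH.secSub hE _).tame_of_b_mem hE ?_)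
      have h3 := D.sec_conj (D.A k) (D.B (D.beta y)) (-1)
      rw [← hk, act_A, sec_A, sec_A, sec_B, if_pos rfl] at h3
      have h4 := D.sec_mem_secSub hy hy0 (-1 + k)
      rw [h3] at h4
      exact D.b_mem_of_B_mem hyb (by simpa using h4)
    -- A section with nonzero exponent sum is shorter than `y`. If it moves the first level, a
    -- section of its `p`-th power replaces it: this is no longer, has the same exponent sum, and
    -- fixes the first level because the entries sum to zero.
    · obtain ⟨x, hx⟩ : ∃ x, D.beta (D.sec y x) ≠ 0 := by
        by_contra! hcon
        apply hyb
        rw [← sum_beta_sec]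
        exact Finset.sum_eq_zero fun x _ => hcon x
      have hlen : D.len (D.sec y x) < n := by
        have := D.len_sec_le y x
        omega
      have hd := hH.secSub hE x
      have hmem := D.sec_mem_secSub hy hy0 x
      refine Tame.of_transitive hh h0 (x := x) ?_
      by_cases hact : D.act (D.sec y x) = 0
      · exact ih _ hlen hd _ hmem hact hx rfl
      · refine Tame.of_transitive hmem hact (x := 0) ?_
        refine ih (D.len (D.sec (D.sec y x ^ p) 0)) ((D.len_sec_pow_p hact 0).trans_lt hlen)
          (hd.secSub hE 0) _ (D.sec_mem_secSub (pow_mem hmem _) (D.act_pow_p _) 0) ?_ ?_ rfl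
        · rw [D.act_sec_pow_p hact, hE, zero_mul]
        · rwa [D.beta_sec_pow_p hact]

variable (D)

/-! ### Generators of sections -/

theorem secSub_closure_of_act_eq_zero {S : Set G} (hS : ∀ s ∈ S, D.act s = 0) (x : ZMod p) :
    D.secSub (Subgroup.closure S) x = Subgroup.closure ((D.sec · x) '' S) := by
  apply le_antisymm
  · intro k hk
    obtain ⟨g, hg, -, rfl⟩ := D.mem_secSub.1 hk
    have key : D.act g = 0 ∧ D.sec g x ∈ Subgroup.closure ((D.sec · x) '' S) := by
      clear hk
      induction hg using Subgroup.closure_induction with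
      | mem g hg => exact ⟨hS g hg, Subgroup.subset_closure ⟨g, hg, rfl⟩⟩
      | one => exact ⟨D.act_one, by rw [sec_one]; exact one_mem _⟩
      | mul g h _ _ ihg ihh =>
        refine ⟨by rw [act_mul, ihg.1, ihh.1, add_zero], ?_⟩
        rw [sec_mul, ihh.1, add_zero]
        exact mul_mem ihg.2 ihh.2
      | inv g _ ih =>
        refine ⟨by rw [act_inv, ih.1, neg_zero], ?_⟩
        rw [sec_inv, ih.1, sub_zero]
        exact inv_mem ih.2
    exact key.2
  · rw [Subgroup.closure_le]
    rintro _ ⟨s, hs, rfl⟩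
    exact D.sec_mem_secSub (Subgroup.subset_closure hs) (hS s hs) x

/-- Schreier generators of the section at `0` of a subgroup that acts transitively on the
first level. -/
theorem secSub_closure_of_transversal {S : Set G} {h : ZMod p → G}
    (hmem : ∀ i, h i ∈ Subgroup.closure S) (hact : ∀ i, D.act (h i) = i) (hone : h 0 = 1) :
    D.secSub (Subgroup.closure S) 0 = Subgroup.closure
      {g | ∃ s ∈ S, ∃ i, g = (D.sec (h (i + D.act s)) 0)⁻¹ * D.sec s i * D.sec (h i) 0} := by
  set T : Set G :=
    {g | ∃ s ∈ S, ∃ i, g = (D.sec (h (i + D.act s)) 0)⁻¹ * D.sec s i * D.sec (h i) 0} with hT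
  apply le_antisymm
  · intro k hk
    obtain ⟨g, hg, hg0, rfl⟩ := D.mem_secSub.1 hk
    -- These expressions multiply like a cocycle: the transversal factors telescope. At `i = 0` the
    -- expression is the section of `g`.
    have key : ∀ i, (D.sec (h (i + D.act g)) 0)⁻¹ * D.sec g i * D.sec (h i) 0 ∈
        Subgroup.closure T := by
      clear hg0 hk
      induction hg using Subgroup.closure_induction with
      | mem g hg => exact fun i => Subgroup.subset_closure ⟨g, hg, i, rfl⟩
      | one => intro i; simp [act_one, sec_one]
      | mul g k _ _ ihg ihk =>
        intro i
        have := mul_mem (ihg (i + D.act k)) (ihk i)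
        rw [act_mul, sec_mul, add_comm (D.act g), ← add_assoc]
        simpa [mul_assoc] using this
      | inv g _ ih =>
        intro i
        have := inv_mem (ih (i - D.act g))
        rw [sub_add_cancel] at this
        rw [act_inv, sec_inv, ← sub_eq_add_neg]
        simpa [mul_assoc] using this
    have := key 0
    rw [hg0, add_zero, hone, sec_one] at this
    simpa using this
  · rw [Subgroup.closure_le]
    rintro _ ⟨s, hs, i, rfl⟩
    refine D.mem_secSub.2 ⟨(h (i + D.act s))⁻¹ * s * h i,
      mul_mem (mul_mem (inv_mem (hmem _)) (Subgroup.subset_closure hs)) (hmem i), ?_, ?_⟩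
    · rw [act_mul, act_mul, act_inv, hact, hact]; ring
    · rw [sec_mul, sec_mul, sec_inv, hact, hact, zero_add, sub_self]

theorem conj_closure (g : G) (S : Set G) :
    conj g (Subgroup.closure S) = Subgroup.closure ((fun s => g * s * g⁻¹) '' S) :=
  MonoidHom.map_closure _ S

/-! ### Transversals consisting of powers -/

/-- The number of powers of `b` in the sections along the first `n` points of the orbit of `0`. -/
noncomputable def orbitLen (x : G) (n : ℕ) : ℕ :=
  ∑ i ∈ Finset.range n, D.len (D.sec x (i * D.act x))

theorem len_sec_pow_zero (x : G) (n : ℕ) : D.len (D.sec (x ^ n) 0) ≤ D.orbitLen x n := by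
  simpa [orbitLen] using D.len_sec_pow x n 0

theorem orbitLen_mono (x : G) : Monotone (D.orbitLen x) := fun _ _ hmn =>
  Finset.sum_le_sum_of_subset (Finset.range_mono hmn)

/-- The inverse of `x ^ (p - n)` induces the same translation as `x ^ n` but runs through the
complementary part of the orbit, so the two lengths share `D.len x`. -/
theorem exists_backward {x : G} (hx : D.act x ≠ 0) {n : ℕ} (hn : n ≤ p) :
    D.act (x ^ (p - n))⁻¹ = n * D.act x ∧
      D.len (D.sec (x ^ (p - n))⁻¹ 0) + D.orbitLen x n ≤ D.len x := by
  have hact : D.act (x ^ (p - n)) = -(n * D.act x) := by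
    rw [act_pow, Nat.cast_sub hn, CharP.cast_eq_zero]; ring
  refine ⟨by rw [act_inv, hact, neg_neg], ?_⟩
  rw [sec_inv, len_inv, hact, zero_sub, neg_neg]
  have h1 := D.len_sec_pow x (p - n) (n * D.act x)
  have h2 : ∑ i ∈ Finset.range p, D.len (D.sec x (i * D.act x)) =
      D.orbitLen x n + ∑ i ∈ Finset.range (p - n), D.len (D.sec x (n * D.act x + i * D.act x)) := by
    have h := Finset.sum_range_add (fun i : ℕ => D.len (D.sec x (i * D.act x))) n (p - n)
    rw [Nat.add_sub_cancel' hn] at h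
    rw [h]
    congr 1
    refine Finset.sum_congr rfl fun i _ => ?_
    push_cast
    rw [add_mul]
  have h3 := sum_range_translate (fun y => D.len (D.sec x y)) 0 hx
  simp only [zero_add] at h3
  have h4 := D.sum_len_sec x
  omega

/-- Of the forward and the backward power reaching a letter, one uses at most half of the length. -/
theorem exists_transversal {H : Subgroup G} {x : G} (hxH : x ∈ H) (hx : D.act x ≠ 0) :
    ∃ h : ZMod p → G, (∀ i, h i ∈ H) ∧ (∀ i, D.act (h i) = i) ∧ h 0 = 1 ∧
      ∀ i, D.len (D.sec (h i) 0) ≤ D.len x / 2 := by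
  have key : ∀ i : ZMod p, ∃ k ∈ H, D.act k = i ∧ (i = 0 → k = 1) ∧
      D.len (D.sec k 0) ≤ D.len x / 2 := by
    intro i
    by_cases hi : i = 0
    · exact ⟨1, one_mem _, by rw [act_one, hi], fun _ => rfl, by simp [sec_one]⟩
    set n := (i / D.act x).val with hn
    have hni : n * D.act x = i := by rw [hn, ZMod.natCast_zmod_val, div_mul_cancel₀ _ hx]
    obtain ⟨h1, h2⟩ := D.exists_backward hx (ZMod.val_lt (i / D.act x)).le
    rw [← hn] at h1 h2
    by_cases hle : D.orbitLen x n ≤ D.len x / 2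
    · exact ⟨x ^ n, pow_mem hxH _, by rw [act_pow, hni], fun h => (hi h).elim,
        (D.len_sec_pow_zero x n).trans hle⟩
    · exact ⟨_, inv_mem (pow_mem hxH _), h1.trans hni, fun h => (hi h).elim, by omega⟩
  choose h h1 h2 h3 h4 using key
  exact ⟨h, h1, h2, h3 0 rfl, h4⟩

/-- After the first `n` with orbit length one, as long as that length stays one, only powers of `a`
are multiplied on the left; so the power of `b` and the right factor are common to all such `n`. -/
theorem exists_sec_pow_eq (x : G) : ∃ m r, ∀ n, D.orbitLen x n = 1 →
    ∃ k, D.sec (x ^ n) 0 = D.A k * D.B m * D.A r := by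
  by_cases hex : ∃ n, D.orbitLen x n = 1
  swap
  · exact ⟨0, 0, fun n hn => (hex ⟨n, hn⟩).elim⟩
  classical
  obtain ⟨k₀, r, hk⟩ := D.exists_eq_A_B_A
    ((D.len_sec_pow_zero x (Nat.find hex)).trans (Nat.find_spec hex).le)
  refine ⟨D.beta (D.sec (x ^ Nat.find hex) 0), r, fun n hn => ?_⟩
  have hle : Nat.find hex ≤ n := Nat.find_min' hex hn
  induction n, hle using Nat.le_induction with
  | base => exact ⟨k₀, hk⟩
  | succ n hle ih =>
    have h1 : D.orbitLen x n = 1 := by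
      have h2 := D.orbitLen_mono x hle
      have h3 := D.orbitLen_mono x (Nat.le_succ n)
      have h4 := Nat.find_spec hex
      simp only [Nat.succ_eq_add_one] at h3
      omega
    obtain ⟨k, hk'⟩ := ih h1
    have h2 : D.len (D.sec x (n * D.act x)) = 0 := by
      rw [orbitLen, Finset.sum_range_succ, ← orbitLen] at hn
      omega
    refine ⟨D.act (D.sec x (n * D.act x)) + k, ?_⟩
    rw [sec_pow, hk', zero_add, D.exists_eq_A h2, act_A, A_add]
    group

/-- Forward powers serve for orbit length zero or one; otherwise the backward power has a section of
length zero. The common `m` and `r` allow one simultaneous conjugation of all Schreier generators.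
-/
theorem exists_transversal_of_len_le_two {H : Subgroup G} {x : G} (hxH : x ∈ H)
    (hx : D.act x ≠ 0) (hlen : D.len x ≤ 2) :
    ∃ (m r : ZMod p) (h : ZMod p → G), (∀ i, h i ∈ H) ∧ (∀ i, D.act (h i) = i) ∧ h 0 = 1 ∧
      ∀ i, ∃ k ε, (ε = 0 ∨ ε = m) ∧ D.sec (h i) 0 = D.A k * D.B ε * D.A r := by
  obtain ⟨m, r, hmr⟩ := D.exists_sec_pow_eq x
  have hA : ∀ {g : G}, D.len g = 0 → ∃ k ε, (ε = 0 ∨ ε = m) ∧ g = D.A k * D.B ε * D.A r :=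
    fun {g} hg => ⟨D.act g - r, 0, Or.inl rfl, by
      rw [B_zero, mul_one, ← A_add, sub_add_cancel]; exact D.exists_eq_A hg⟩
  have key : ∀ i : ZMod p, ∃ g ∈ H, D.act g = i ∧ (i = 0 → g = 1) ∧
      ∃ k ε, (ε = 0 ∨ ε = m) ∧ D.sec g 0 = D.A k * D.B ε * D.A r := by
    intro i
    by_cases hi : i = 0
    · exact ⟨1, one_mem _, by rw [act_one, hi], fun _ => rfl, hA (by simp [sec_one])⟩
    set n := (i / D.act x).val with hn
    have hni : n * D.act x = i := by rw [hn, ZMod.natCast_zmod_val, div_mul_cancel₀ _ hx]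
    obtain ⟨h1, h2⟩ := D.exists_backward hx (ZMod.val_lt (i / D.act x)).le
    rw [← hn] at h1 h2
    have hfw : D.act (x ^ n) = i := by rw [act_pow, hni]
    have h3 := D.len_sec_pow_zero x n
    by_cases hone : D.orbitLen x n = 1
    · obtain ⟨k, hk⟩ := hmr n hone
      exact ⟨x ^ n, pow_mem hxH _, hfw, fun h => (hi h).elim, k, m, Or.inr rfl, hk⟩
    by_cases hzero : D.orbitLen x n = 0
    · exact ⟨x ^ n, pow_mem hxH _, hfw, fun h => (hi h).elim, hA (by omega)⟩
    · exact ⟨_, inv_mem (pow_mem hxH _), h1.trans hni, fun h => (hi h).elim, hA (by omega)⟩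
  choose h h1 h2 h3 h4 using key
  exact ⟨m, r, h, h1, h2, h3 0 rfl, h4⟩

/-! ### Finitely generated subgroups are tame -/

variable {D}

/-- The group is contained in a cyclic group of order dividing `p`, or it contains both `a` and `b`.
-/
theorem tame_closure_of_powers {S : Set G} (hS : ∀ s ∈ S, (∃ k, s = D.A k) ∨ ∃ k, s = D.B k) :
    D.Tame (Subgroup.closure S) := by
  have hfin : ∀ g : G, g ^ p = 1 → Subgroup.closure S ≤ Subgroup.zpowers g →
      D.Tame (Subgroup.closure S) := by
    intro g hg hle
    have h1 : IsOfFinOrder g := isOfFinOrder_iff_pow_eq_one.2 ⟨p, hp.out.pos, hg⟩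
    have h2 : Finite (Subgroup.zpowers g) := Set.finite_coe_iff.2 h1.finite_zpowers
    exact Tame.of_finite _ (Finite.Set.subset (Subgroup.zpowers g : Set G) hle)
  by_cases hA : ∀ s ∈ S, ∃ k, s = D.A k
  · refine hfin D.a D.a_pow_p ((Subgroup.closure_le _).2 fun s hs => ?_)
    obtain ⟨k, rfl⟩ := hA s hs
    exact Subgroup.npow_mem_zpowers _ _
  by_cases hB : ∀ s ∈ S, ∃ k, s = D.B k
  · refine hfin D.b D.b_pow_p ((Subgroup.closure_le _).2 fun s hs => ?_)
    obtain ⟨k, rfl⟩ := hB s hs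
    exact Subgroup.npow_mem_zpowers _ _
  push Not at hA hB
  obtain ⟨s, hs, hsA⟩ := hA
  obtain ⟨t, ht, htB⟩ := hB
  obtain ⟨k, rfl⟩ := (hS s hs).resolve_left fun ⟨k, hk⟩ => hsA k hk
  obtain ⟨l, rfl⟩ := (hS t ht).resolve_right fun ⟨k, hk⟩ => htB k hk
  have hk : k ≠ 0 := by rintro rfl; exact hsA 0 (by simp)
  have hl : l ≠ 0 := by rintro rfl; exact htB 0 (by simp)
  rw [D.eq_top_of_mem (D.a_mem_of_A_mem hl (Subgroup.subset_closure ht))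
    (D.b_mem_of_B_mem hk (Subgroup.subset_closure hs))]
  exact Tame.top

theorem sec_eq_power_of_len_le_one {s : G} (h1 : D.len s ≤ 1) (h0 : D.act s = 0) (x : ZMod p) :
    (∃ k, D.sec s x = D.A k) ∨ ∃ k, D.sec s x = D.B k := by
  obtain ⟨k, hk⟩ := D.exists_eq_conj_B h1 h0
  have h3 := D.sec_conj (D.A k) (D.B (D.beta s)) (x - k)
  rw [← hk, act_A, sec_A, sec_A, sub_add_cancel, one_mul, inv_one, mul_one, sec_B] at h3
  rw [h3]
  split_ifs
  exacts [Or.inr ⟨_, rfl⟩, Or.inl ⟨_, rfl⟩]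

theorem tame_closure_of_len_le_one_of_act {S : Set G} (hS : ∀ s ∈ S, D.len s ≤ 1)
    (h0 : ∀ s ∈ S, D.act s = 0) : D.Tame (Subgroup.closure S) := by
  refine Tame.of_sections _ fun x => ?_
  rw [D.secSub_closure_of_act_eq_zero h0]
  refine tame_closure_of_powers ?_
  rintro _ ⟨s, hs, rfl⟩
  exact sec_eq_power_of_len_le_one (hS s hs) (h0 s hs) x

/-- To prove tameness of a subgroup transitive on the first level, one may assume that its section
fixes the first level. -/
theorem tame_of_transversal (hE : ∑ x, E x = 0) {S : Set G} {h : ZMod p → G}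
    (hmem : ∀ i, h i ∈ Subgroup.closure S) (hact : ∀ i, D.act (h i) = i) (hone : h 0 = 1)
    (key : ∀ T : Set G, (T = {g | ∃ s ∈ S, ∃ i,
      g = (D.sec (h (i + D.act s)) 0)⁻¹ * D.sec s i * D.sec (h i) 0}) →
      (∀ g ∈ T, D.act g = 0) → D.Tame (Subgroup.closure T)) :
    D.Tame (Subgroup.closure S) := by
  have h1 : D.act (h 1) ≠ 0 := by rw [hact]; exact one_ne_zero
  refine Tame.of_transitive (hmem 1) h1 (x := 0) ?_
  rcases D.dense_or_le_St hE (hmem 1) h1 0 with hd | hle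
  · exact hd.tame hE
  · rw [D.secSub_closure_of_transversal hmem hact hone] at hle ⊢
    exact key _ rfl fun g hg => hle (Subgroup.subset_closure hg)

/-- The transversal coming from `x` has sections of length zero, so the Schreier generators have
length at most one. -/
theorem tame_closure_of_short_mover (hE : ∑ x, E x = 0) {S : Set G} (hS : ∀ s ∈ S, D.len s ≤ 2)
    {x : G} (hx : x ∈ S) (hx0 : D.act x ≠ 0) (hx1 : D.len x ≤ 1) :
    D.Tame (Subgroup.closure S) := by
  obtain ⟨h, hmem, hact, hone, hlen⟩ :=
    D.exists_transversal (Subgroup.subset_closure hx : x ∈ Subgroup.closure S) hx0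
  refine tame_of_transversal hE hmem hact hone fun T hT hT0 =>
    tame_closure_of_len_le_one_of_act ?_ hT0
  subst hT
  rintro _ ⟨s, hs, i, rfl⟩
  have h1 := D.len_mul ((D.sec (h (i + D.act s)) 0)⁻¹ * D.sec s i) (D.sec (h i) 0)
  have h2 := D.len_mul (D.sec (h (i + D.act s)) 0)⁻¹ (D.sec s i)
  rw [len_inv] at h2
  have h3 := hlen i
  have h4 := hlen (i + D.act s)
  have h5 := D.len_sec_le s i
  have h6 := hS s hs
  omega

theorem tame_closure_of_len_le_one (hE : ∑ x, E x = 0) {S : Set G} (hS : ∀ s ∈ S, D.len s ≤ 1) :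
    D.Tame (Subgroup.closure S) := by
  by_cases h0 : ∀ s ∈ S, D.act s = 0
  · exact tame_closure_of_len_le_one_of_act hS h0
  · push Not at h0
    obtain ⟨x, hx, hx0⟩ := h0
    exact tame_closure_of_short_mover hE (fun s hs => (hS s hs).trans one_le_two) hx hx0 (hS x hx)

/-- Unless a generator of length at most one moves the first level, each nontrivial power of `a`
occurs with `ε = ε' = m`. Conjugation by `b ^ m` then turns all generators into powers of `a` or
`b`. -/
theorem tame_closure_of_conj_powers (hE : ∑ x, E x = 0) {S : Set G} (m : ZMod p)
    (hS : ∀ s ∈ S, ∃ ε ε' v, (ε = 0 ∨ ε = m) ∧ (ε' = 0 ∨ ε' = m) ∧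
      ((∃ k, v = D.A k) ∨ ∃ k, v = D.B k) ∧ s = (D.B ε)⁻¹ * v * D.B ε') :
    D.Tame (Subgroup.closure S) := by
  by_cases hex : ∃ s ∈ S, D.act s ≠ 0 ∧ D.len s ≤ 1
  · obtain ⟨x, hx, hx0, hx1⟩ := hex
    refine tame_closure_of_short_mover hE (fun s hs => ?_) hx hx0 hx1
    obtain ⟨ε, ε', v, -, -, ⟨k, rfl⟩ | ⟨k, rfl⟩, rfl⟩ := hS s hs
    · have h1 := D.len_mul ((D.B ε)⁻¹ * D.A k) (D.B ε')
      have h2 := D.len_mul (D.B ε)⁻¹ (D.A k)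
      rw [len_inv, len_A] at h2
      have h3 := D.len_B ε
      have h4 := D.len_B ε'
      omega
    · rw [← B_neg, ← B_add, ← B_add]
      exact (D.len_B _).trans one_le_two
  · push Not at hex
    refine Tame.of_conj (D.B m) ?_
    rw [conj_closure]
    refine tame_closure_of_powers ?_
    rintro _ ⟨s, hs, rfl⟩
    obtain ⟨ε, ε', v, hε, hε', ⟨k, rfl⟩ | ⟨k, rfl⟩, rfl⟩ := hS s hs
    · by_cases hk : k = 0
      · right
        refine ⟨m + (-ε + ε' + -m), ?_⟩
        simp only [hk, A_zero, mul_one, B_add, B_neg, mul_assoc]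
      · have hact : D.act ((D.B ε)⁻¹ * D.A k * D.B ε') ≠ 0 := by
          rw [act_mul, act_mul, act_inv]; simpa using hk
        have hlen : ¬ D.len ((D.B ε)⁻¹ * D.A k * D.B ε') ≤ 1 := fun h => by
          have := hex _ hs hact
          omega
        have hlen2 : D.len ((D.B ε)⁻¹ * D.A k) ≤ D.len (D.B ε) := by
          have h2 := D.len_mul (D.B ε)⁻¹ (D.A k)
          rwa [len_inv, len_A, add_zero] at h2
        have h1 := D.len_mul ((D.B ε)⁻¹ * D.A k) (D.B ε')
        have h3 := D.len_B ε
        have h4 := D.len_B ε'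
        have h5 : D.len (D.B 0) = 0 := by rw [B_zero, len_one]
        rcases hε with rfl | rfl
        · omega
        rcases hε' with rfl | rfl
        · omega
        · exact Or.inl ⟨k, by group⟩
    · right
      refine ⟨m + (-ε + k + ε' + -m), ?_⟩
      simp only [B_add, B_neg, mul_assoc]

/-- At `-1` the sections have the shape treated in `tame_closure_of_conj_powers`; at other letters
the outer powers of `b` become powers of `a`, and the length is at most one. -/
theorem tame_closure_of_conj_short (hE : ∑ x, E x = 0) {S : Set G} (m : ZMod p)
    (hS : ∀ s ∈ S, ∃ ε ε' v, (ε = 0 ∨ ε = m) ∧ (ε' = 0 ∨ ε' = m) ∧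
      D.len v ≤ 1 ∧ D.act v = 0 ∧ s = (D.B ε)⁻¹ * v * D.B ε') :
    D.Tame (Subgroup.closure S) := by
  have h0 : ∀ s ∈ S, D.act s = 0 := by
    intro s hs
    obtain ⟨ε, ε', v, -, -, -, hv, rfl⟩ := hS s hs
    rw [act_mul, act_mul, act_inv, hv]
    simp
  have hsec : ∀ ε ε' v x, D.act v = 0 → D.sec ((D.B ε)⁻¹ * v * D.B ε') x =
      (D.sec (D.B ε) x)⁻¹ * D.sec v x * D.sec (D.B ε') x := by
    intro ε ε' v x hv
    rw [sec_mul, sec_mul, sec_inv, hv]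
    simp
  refine Tame.of_sections _ fun x => ?_
  rw [D.secSub_closure_of_act_eq_zero h0]
  by_cases hx : x = -1
  · refine tame_closure_of_conj_powers hE m ?_
    rintro _ ⟨s, hs, rfl⟩
    obtain ⟨ε, ε', v, hε, hε', hv1, hv, rfl⟩ := hS s hs
    refine ⟨ε, ε', D.sec v x, hε, hε', sec_eq_power_of_len_le_one hv1 hv x, ?_⟩
    change D.sec _ x = _
    rw [hsec _ _ _ _ hv, sec_B, sec_B, if_pos hx, if_pos hx]
  · refine tame_closure_of_len_le_one hE ?_
    rintro _ ⟨s, hs, rfl⟩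
    obtain ⟨ε, ε', v, hε, hε', hv1, hv, rfl⟩ := hS s hs
    change D.len (D.sec _ x) ≤ 1
    rw [hsec _ _ _ _ hv, sec_B, sec_B, if_neg hx, if_neg hx]
    have h1 := D.len_mul ((D.A (E x * ε))⁻¹ * D.sec v x) (D.A (E x * ε'))
    have h2 := D.len_mul (D.A (E x * ε))⁻¹ (D.sec v x)
    rw [len_inv, len_A] at h2
    rw [len_A] at h1
    have h3 := D.len_sec_le v x
    omega

/-- The general estimate stalls at length two, hence the finer transversal: after conjugation by `a
^ r` its Schreier generators are short elements between powers of `b` with exponents `0` or `m` up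
to sign. -/
theorem tame_closure_of_len_le_two (hE : ∑ x, E x = 0) {S : Set G} (hS : ∀ s ∈ S, D.len s ≤ 2) :
    D.Tame (Subgroup.closure S) := by
  by_cases h0 : ∀ s ∈ S, D.act s = 0
  · refine Tame.of_sections _ fun x => ?_
    rw [D.secSub_closure_of_act_eq_zero h0]
    refine tame_closure_of_len_le_one hE ?_
    rintro _ ⟨s, hs, rfl⟩
    have h1 := D.len_sec_le s x
    have h2 := hS s hs
    change D.len (D.sec s x) ≤ 1
    omega
  push Not at h0
  obtain ⟨x, hx, hx0⟩ := h0
  obtain ⟨m, r, h, hmem, hact, hone, hform⟩ := D.exists_transversal_of_len_le_two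
    (Subgroup.subset_closure hx : x ∈ Subgroup.closure S) hx0 (hS x hx)
  refine tame_of_transversal hE hmem hact hone fun T hT hT0 => Tame.of_conj (D.A r) ?_
  rw [conj_closure]
  refine tame_closure_of_conj_short hE m ?_
  rintro _ ⟨g, hg, rfl⟩
  have hg0 := hT0 g hg
  subst hT
  obtain ⟨s, hs, i, rfl⟩ := hg
  obtain ⟨k, ε, hε, hk⟩ := hform (i + D.act s)
  obtain ⟨k', ε', hε', hk'⟩ := hform i
  rw [hk, hk'] at hg0 ⊢
  refine ⟨ε, ε', (D.A k)⁻¹ * D.sec s i * D.A k', hε, hε', ?_, ?_, by group⟩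
  · have h1 := D.len_mul ((D.A k)⁻¹ * D.sec s i) (D.A k')
    have h2 := D.len_mul (D.A k)⁻¹ (D.sec s i)
    rw [len_inv, len_A] at h2
    rw [len_A] at h1
    have h3 := D.len_sec_le s i
    have h4 := hS s hs
    omega
  · simp only [act_mul, act_inv, act_A, act_B] at hg0 ⊢
    rw [← hg0]
    ring

/-- A subgroup generated by elements of bounded length is tame. -/
theorem tame_closure (hE : ∑ x, E x = 0) (n : ℕ) {S : Set G} (hS : ∀ s ∈ S, D.len s ≤ n) :
    D.Tame (Subgroup.closure S) := by
  induction n using Nat.strong_induction_on generalizing S with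
  | _ n ih =>
    by_cases hn : n ≤ 2
    · exact tame_closure_of_len_le_two hE fun s hs => (hS s hs).trans hn
    have hfix : ∀ {T : Set G} {m : ℕ}, (m + 1) / 2 < n → (∀ s ∈ T, D.len s ≤ m) →
        (∀ s ∈ T, D.act s = 0) → D.Tame (Subgroup.closure T) := by
      intro T m hm hT h0
      refine Tame.of_sections _ fun x => ?_
      rw [D.secSub_closure_of_act_eq_zero h0]
      refine ih _ hm ?_
      rintro _ ⟨s, hs, rfl⟩
      have h1 := D.len_sec_le s x
      have h2 := hT s hs
      change D.len (D.sec s x) ≤ _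
      omega
    by_cases h0 : ∀ s ∈ S, D.act s = 0
    · exact hfix (by omega) hS h0
    push Not at h0
    obtain ⟨x, hx, hx0⟩ := h0
    obtain ⟨h, hmem, hact, hone, hlen⟩ :=
      D.exists_transversal (Subgroup.subset_closure hx : x ∈ Subgroup.closure S) hx0
    refine tame_of_transversal hE hmem hact hone fun T hT hT0 =>
      -- Two transversal sections and one section of a generator; halving this bound once more gives
      -- less than `n` because `n ≥ 3`.
      hfix (m := n / 2 + (n + 1) / 2 + n / 2) (by omega) ?_ hT0
    subst hT
    rintro _ ⟨s, hs, i, rfl⟩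
    have h1 := D.len_mul ((D.sec (h (i + D.act s)) 0)⁻¹ * D.sec s i) (D.sec (h i) 0)
    have h2 := D.len_mul (D.sec (h (i + D.act s)) 0)⁻¹ (D.sec s i)
    rw [len_inv] at h2
    have h3 := hlen i
    have h4 := hlen (i + D.act s)
    have h5 := D.len_sec_le s i
    have h6 := hS s hs
    have h7 := hS x hx
    omega

/-- Finitely generated subgroups are tame. -/
theorem tame_of_fg (hE : ∑ x, E x = 0) {H : Subgroup G} (hH : H.FG) : D.Tame H := by
  obtain ⟨S, rfl⟩ := hH
  exact tame_closure hE (S.sup D.len) fun s hs => Finset.le_sup (f := D.len) hs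

end GGSData

/-- The abelianisation of `L` is finitely generated and torsion, hence finite. -/
theorem finiteIndex_commutator {G : Type*} [Group G] (ht : IsMulTorsion G) (hfg : Group.FG G)
    {L : Subgroup G} (hL : L.FiniteIndex) : (⁅L, L⁆).FiniteIndex := by
  have h1 : Group.FG L := inferInstance
  have h2 : IsMulTorsion L := fun g => Submonoid.isOfFinOrder_coe.1 (ht g)
  have h3 : IsMulTorsion (Abelianization L) := by
    intro g
    obtain ⟨l, rfl⟩ := QuotientGroup.mk_surjective g
    exact MonoidHom.isOfFinOrder (Abelianization.of (G := L)) (h2 l)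
  have h4 : Group.FG (Abelianization L) :=
    Group.fg_of_surjective (f := Abelianization.of (G := L)) QuotientGroup.mk_surjective
  have h5 : Finite (Abelianization L) := CommGroup.finite_of_fg_isMulTorsion _ h3
  have h6 : (commutator L).FiniteIndex := Subgroup.finiteIndex_iff_finite_quotient.2 h5
  have h7 : (commutator L).map L.subtype = ⁅L, L⁆ := by
    rw [commutator_def, Subgroup.map_commutator, ← MonoidHom.range_eq_map, Subgroup.range_subtype]
  rw [← h7]
  exact finiteIndex_map_subtype hL h6

namespace GGSData

variable {p : ℕ} [hp : Fact p.Prime] {E : ZMod p → ZMod p} {G : Type*} [Group G]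
  (D : GGSData p E G)

/-! ### Subgroups defined by conditions on the sections -/

theorem finiteIndex_St : D.St.FiniteIndex := by
  let f : G →* Multiplicative (ZMod p) :=
    { toFun := fun g => Multiplicative.ofAdd (D.act g)
      map_one' := by rw [act_one]; rfl
      map_mul' := fun g h => by rw [act_mul]; rfl }
  have h : f.ker = D.St := by
    ext g
    exact Iff.rfl
  rw [← h]
  have : Finite (Multiplicative (ZMod p)) := inferInstanceAs (Finite (ZMod p))
  infer_instance

theorem one_lt_index_St : 1 < D.St.index := by
  have h0 := D.finiteIndex_St.1
  have h1 : D.St.index ≠ 1 := fun h => by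
    rw [Subgroup.index_eq_one] at h
    have : D.a ∈ D.St := h ▸ Subgroup.mem_top _
    rw [mem_St, D.act_a] at this
    exact one_ne_zero this
  omega

/-- The elements of the first level stabiliser with sections in given subgroups. -/
def lift (A : ZMod p → Subgroup G) : Subgroup G :=
  (⨅ x, (A x).comap (D.secHom x)).map D.St.subtype

theorem mem_lift {A : ZMod p → Subgroup G} {g : G} :
    g ∈ D.lift A ↔ D.act g = 0 ∧ ∀ x, D.sec g x ∈ A x := by
  constructor
  · rintro ⟨h, hh, rfl⟩
    exact ⟨h.2, fun x => (Subgroup.mem_iInf.1 hh x :)⟩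
  · rintro ⟨h0, h⟩
    exact ⟨⟨g, h0⟩, Subgroup.mem_iInf.2 h, rfl⟩

theorem finiteIndex_lift {A : ZMod p → Subgroup G} (hA : ∀ x, (A x).FiniteIndex) :
    (D.lift A).FiniteIndex :=
  finiteIndex_map_subtype D.finiteIndex_St
    (Subgroup.finiteIndex_iInf fun x => finiteIndex_comap _ (hA x))

theorem separable_lift {A : ZMod p → Subgroup G} (hA : ∀ x, Separable (A x)) :
    Separable (D.lift A) :=
  Separable.map_subtype D.finiteIndex_St (Separable.iInf fun x => (hA x).comap _)

theorem relIndex_lift_ne_zero {A B : ZMod p → Subgroup G} (h : ∀ x, (A x).relIndex (B x) ≠ 0) :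
    (D.lift A).relIndex (D.lift B) ≠ 0 := by
  rw [lift, lift, Subgroup.relIndex_map_map_of_injective _ _ D.St.subtype_injective]
  refine Subgroup.relIndex_iInf_ne_zero fun x h0 => ?_
  exact Subgroup.relIndex_comap_ne_zero (D.secHom x) (h x)
    (Subgroup.relIndex_eq_zero_of_le_right (iInf_le _ x) h0)

theorem exists_finiteIndex_act_foldl (w : List (ZMod p)) :
    ∃ F : Subgroup G, F.FiniteIndex ∧ ∀ g ∈ F, D.act (w.foldl D.sec g) = 0 := by
  induction w with
  | nil => exact ⟨D.St, D.finiteIndex_St, fun g hg => hg⟩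
  | cons x w ih =>
    obtain ⟨F, hF, h⟩ := ih
    exact ⟨D.lift fun _ => F, D.finiteIndex_lift fun _ => hF,
      fun g hg => h _ ((D.mem_lift.1 hg).2 x)⟩

theorem exists_act_foldl_ne_zero {g : G} (hg : g ≠ 1) :
    ∃ w : List (ZMod p), D.act (w.foldl D.sec g) ≠ 0 := by
  by_contra! h
  exact hg (D.faithful g h)

theorem separable_bot (D : GGSData p E G) : Separable (⊥ : Subgroup G) := by
  intro g hg
  obtain ⟨w, hw⟩ := D.exists_act_foldl_ne_zero (g := g) (by simpa using hg)
  obtain ⟨F, hF, h⟩ := D.exists_finiteIndex_act_foldl w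
  exact ⟨F, hF, bot_le, fun hgF => hw (h g hgF)⟩

/-- Powers of `a` identify the sections at all letters, and `b` contributes `b` at `-1` and a
nontrivial power of `a` elsewhere. -/
theorem secSub_top (x : ZMod p) : D.secSub (⊤ : Subgroup G) x = ⊤ := by
  have htr : ∀ y, D.secSub (⊤ : Subgroup G) y = D.secSub ⊤ x := fun y => by
    have h1 := D.secSub_translate (H := ⊤) (h := D.A (y - x)) (Subgroup.mem_top _) x
    rwa [act_A, sec_A, conj_one, add_sub_cancel] at h1
  obtain ⟨i, hi, hEi⟩ := D.exists_E_ne_zero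
  refine D.eq_top_of_mem ?_ ?_
  · rw [← htr i]
    have h3 := D.sec_mem_secSub (Subgroup.mem_top D.b) D.act_b i
    rw [sec_b, if_neg hi] at h3
    exact D.a_mem_of_A_mem hEi h3
  · rw [← htr (-1)]
    have h3 := D.sec_mem_secSub (Subgroup.mem_top D.b) D.act_b (-1)
    rwa [sec_b, if_pos rfl] at h3

theorem exists_sec_eq (g : G) (x : ZMod p) : ∃ h, D.act h = 0 ∧ D.sec h x = g := by
  have h : g ∈ D.secSub ⊤ x := by rw [secSub_top]; trivial
  obtain ⟨h, -, h0, hg⟩ := D.mem_secSub.1 h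
  exact ⟨h, h0, hg⟩

theorem secHom_surjective (x : ZMod p) : Function.Surjective (D.secHom x) := fun g => by
  obtain ⟨h, h0, hg⟩ := D.exists_sec_eq g x
  exact ⟨⟨h, h0⟩, hg⟩

theorem index_secSub_dvd (H : Subgroup G) (x : ZMod p) :
    (D.secSub H x).index ∣ H.relIndex D.St :=
  Subgroup.index_map_dvd _ (D.secHom_surjective x)

theorem finiteIndex_secSub {H : Subgroup G} (hH : H.FiniteIndex) (x : ZMod p) :
    (D.secSub H x).FiniteIndex :=
  ⟨fun h => (Subgroup.isFiniteRelIndex_of_finiteIndex (H := H) (K := D.St)).relIndex_ne_zero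
    (Nat.eq_zero_of_zero_dvd (h ▸ D.index_secSub_dvd H x))⟩

theorem relIndex_secSub_ne_zero {H K : Subgroup G} (h : H.relIndex K ≠ 0) (x : ZMod p) :
    (D.secSub H x).relIndex (D.secSub K x) ≠ 0 := by
  refine relIndex_map_ne_zero _ ?_
  exact Subgroup.relIndex_comap_ne_zero D.St.subtype h

theorem secSub_normal {H : Subgroup G} (hH : H.Normal) (x : ZMod p) : (D.secSub H x).Normal :=
  Subgroup.Normal.map inferInstance _ (D.secHom_surjective x)

theorem secSub_eq_of_normal {H : Subgroup G} (hH : H.Normal) (x : ZMod p) :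
    D.secSub H x = D.secSub H 0 := by
  have h1 : conj (D.A x) H = H := by
    ext k
    rw [mem_conj]
    constructor
    · intro h
      simpa [mul_assoc] using hH.conj_mem _ h (D.A x)
    · intro h
      simpa [mul_assoc] using hH.conj_mem _ h (D.A x)⁻¹
  have h2 := D.secSub_conj (D.A x) H 0
  rwa [h1, act_A, sec_A, conj_one, zero_add] at h2

theorem index_secSub_le {H : Subgroup G} (hH : H.FiniteIndex) (x : ZMod p) :
    (D.secSub H x).index ≤ H.index := by
  have h1 : H.relIndex D.St ≠ 0 :=
    (Subgroup.isFiniteRelIndex_of_finiteIndex (H := H) (K := D.St)).relIndex_ne_zero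
  refine (Nat.le_of_dvd (Nat.pos_of_ne_zero h1) (D.index_secSub_dvd H x)).trans ?_
  rw [← Subgroup.relIndex_top_right H]
  exact Subgroup.relIndex_le_of_le_right le_top (by rw [Subgroup.relIndex_top_right]; exact hH.1)

theorem index_secSub_lt {H : Subgroup G} (hH : H.FiniteIndex) (hle : H ≤ D.St) (x : ZMod p) :
    (D.secSub H x).index < H.index := by
  have h1 : H.relIndex D.St ≠ 0 :=
    (Subgroup.isFiniteRelIndex_of_finiteIndex (H := H) (K := D.St)).relIndex_ne_zero
  refine (Nat.le_of_dvd (Nat.pos_of_ne_zero h1) (D.index_secSub_dvd H x)).trans_lt ?_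
  rw [← Subgroup.relIndex_mul_index hle]
  exact lt_mul_of_one_lt_right (Nat.pos_of_ne_zero h1) D.one_lt_index_St

/-! ### Rigid stabilisers -/

/-- The elements that act only below the letter `x`. -/
def rist (x : ZMod p) : Subgroup G := D.lift fun y => if y = x then ⊤ else ⊥

theorem mem_rist {x : ZMod p} {g : G} :
    g ∈ D.rist x ↔ D.act g = 0 ∧ ∀ y ≠ x, D.sec g y = 1 := by
  rw [rist, mem_lift]
  refine and_congr_right fun _ => forall_congr' fun y => ?_
  split_ifs with h <;> simp [h]

/-- The elements `g` for which the element acting as `g` below `x` and trivially elsewhere lies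
in `R`. -/
def ristSub (R : Subgroup G) (x : ZMod p) : Subgroup G := D.secSub (R ⊓ D.rist x) x

theorem mem_ristSub {R : Subgroup G} {x : ZMod p} {g : G} :
    g ∈ D.ristSub R x ↔ ∃ h ∈ R, D.act h = 0 ∧ D.sec h x = g ∧ ∀ y ≠ x, D.sec h y = 1 := by
  rw [ristSub, mem_secSub]
  constructor
  · rintro ⟨h, ⟨hR, hr⟩, h0, hg⟩
    exact ⟨h, hR, h0, hg, (D.mem_rist.1 hr).2⟩
  · rintro ⟨h, hR, h0, hg, h1⟩
    exact ⟨h, ⟨hR, D.mem_rist.2 ⟨h0, h1⟩⟩, h0, hg⟩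

theorem sec_commutator {g h : G} (hg : D.act g = 0) (hh : D.act h = 0) (x : ZMod p) :
    D.sec ⁅g, h⁆ x = ⁅D.sec g x, D.sec h x⁆ :=
  map_commutatorElement (D.secHom x) (⟨g, hg⟩ : D.St) ⟨h, hh⟩

theorem act_commutator (g h : G) : D.act ⁅g, h⁆ = 0 := by
  rw [commutatorElement_def, act_mul, act_mul, act_mul, act_inv, act_inv]; ring

/-- The sections at `-1` of the elements acting only below `-1` and `j`. -/
def twoPoint (j : ZMod p) : Subgroup G :=
  D.secSub (D.lift fun y => if y = -1 ∨ y = j then ⊤ else ⊥) (-1)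

theorem mem_twoPoint {j : ZMod p} {g : G} : g ∈ D.twoPoint j ↔
    ∃ h, D.act h = 0 ∧ D.sec h (-1) = g ∧ ∀ y, y ≠ -1 → y ≠ j → D.sec h y = 1 := by
  rw [twoPoint, mem_secSub]
  constructor
  · rintro ⟨h, hl, h0, hg⟩
    refine ⟨h, h0, hg, fun y h1 h2 => ?_⟩
    have := (D.mem_lift.1 hl).2 y
    rw [if_neg (by tauto)] at this
    exact this
  · rintro ⟨h, h0, hg, h1⟩
    refine ⟨h, D.mem_lift.2 ⟨h0, fun y => ?_⟩, h0, hg⟩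
    split_ifs with hy
    · trivial
    · push Not at hy
      exact h1 y hy.1 hy.2

theorem twoPoint_normal (j : ZMod p) : (D.twoPoint j).Normal := by
  refine ⟨fun n hn g => ?_⟩
  obtain ⟨h, h0, rfl, h1⟩ := D.mem_twoPoint.1 hn
  obtain ⟨k, hk0, rfl⟩ := D.exists_sec_eq g (-1)
  have hs : ∀ x, D.sec (k * h * k⁻¹) x = D.sec k x * D.sec h x * (D.sec k x)⁻¹ := fun x => by
    have := D.sec_conj k h x
    rwa [hk0, h0, add_zero] at this
  refine D.mem_twoPoint.2 ⟨k * h * k⁻¹, by rw [act_conj, h0], hs _, fun y hy1 hy2 => ?_⟩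
  rw [hs, h1 y hy1 hy2]
  group

/-- Modulo `L` the two generators commute. -/
theorem commutator_le_of_commutator_mem (D : GGSData p E G) {L : Subgroup G} (hL : L.Normal)
    (h : ⁅D.b, D.a⁆ ∈ L) : commutator G ≤ L := by
  have key : ∀ s ∈ ({D.a, D.b} : Set G), ∀ t ∈ ({D.a, D.b} : Set G), ⁅s, t⁆ ∈ L := by
    have h' : ⁅D.a, D.b⁆ ∈ L := by
      rw [← commutatorElement_inv]
      exact inv_mem h
    rintro s (rfl | rfl) t (rfl | rfl) <;> simp [h, h', one_mem]
  have h1 : ∀ s ∈ ({D.a, D.b} : Set G), ∀ g : G, ⁅s, g⁆ ∈ L := by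
    intro s hs g
    have hg : g ∈ Subgroup.closure {D.a, D.b} := by rw [closure_eq_top]; trivial
    rw [← QuotientGroup.eq_one_iff, ← QuotientGroup.mk'_apply, map_commutatorElement,
      commutatorElement_eq_one_iff_commute]
    induction hg using Subgroup.closure_induction with
    | mem t ht =>
      rw [← commutatorElement_eq_one_iff_commute, ← map_commutatorElement,
        QuotientGroup.mk'_apply, QuotientGroup.eq_one_iff]
      exact key s hs t ht
    | one => rw [map_one]; exact Commute.one_right _
    | mul g k _ _ ihg ihk => rw [map_mul]; exact ihg.mul_right ihk
    | inv g _ ih => rw [map_inv]; exact ih.inv_right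
  rw [commutator_def, Subgroup.commutator_le]
  rintro g - k -
  have hg : g ∈ Subgroup.closure {D.a, D.b} := by rw [closure_eq_top]; trivial
  rw [← QuotientGroup.eq_one_iff, ← QuotientGroup.mk'_apply, map_commutatorElement,
    commutatorElement_eq_one_iff_commute]
  induction hg using Subgroup.closure_induction with
  | mem s hs =>
    rw [← commutatorElement_eq_one_iff_commute, ← map_commutatorElement,
      QuotientGroup.mk'_apply, QuotientGroup.eq_one_iff]
    exact h1 s hs k
  | one => rw [map_one]; exact Commute.one_left _
  | mul g k _ _ ihg ihk => rw [map_mul]; exact ihg.mul_left ihk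
  | inv g _ ih => rw [map_inv]; exact ih.inv_left

/-- The commutator of `b` with its conjugate by `a ^ (-1 - i)` is trivial except at `-1` and `-2 -
i`, since elsewhere both sections are powers of `a`. Its section at `-1` is the commutator of `b`
with `a ^ E i`, and `a` is a power of `a ^ E i`. -/
theorem commutator_le_twoPoint {i : ZMod p} (hi : i ≠ -1) (hEi : E i ≠ 0) :
    commutator G ≤ D.twoPoint (-2 - i) := by
  have hnorm := D.twoPoint_normal (-2 - i)
  refine D.commutator_le_of_commutator_mem hnorm ?_
  set k : ZMod p := -1 - i with hk
  set c := D.A k * D.b * (D.A k)⁻¹ with hc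
  have hc0 : D.act c = 0 := by rw [hc, act_conj, D.act_b]
  have hcs : ∀ x, D.sec c x = D.sec D.b (x - k) := fun x => by
    have := D.sec_conj (D.A k) D.b (x - k)
    rw [act_A, sec_A, sec_A, sub_add_cancel] at this
    simpa using this
  have hmem : ⁅D.b, D.A (E i)⁆ ∈ D.twoPoint (-2 - i) := by
    refine D.mem_twoPoint.2 ⟨⁅D.b, c⁆, D.act_commutator _ _, ?_, fun y hy1 hy2 => ?_⟩
    · rw [D.sec_commutator D.act_b hc0, hcs, sec_b, if_pos rfl]
      have : -1 - k = i := by rw [hk]; ring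
      rw [this, sec_b, if_neg hi]
      rfl
    · rw [D.sec_commutator D.act_b hc0, hcs, sec_b, if_neg hy1, sec_b, if_neg,
        commutatorElement_eq_one_iff_commute]
      · exact ((Commute.refl D.a).pow_left _).pow_right _
      · intro h
        apply hy2
        rw [sub_eq_iff_eq_add] at h
        rw [h, hk]
        ring
  rw [← QuotientGroup.eq_one_iff, ← QuotientGroup.mk'_apply, map_commutatorElement,
      commutatorElement_eq_one_iff_commute] at hmem ⊢
  rw [← A_one, ← mul_inv_cancel₀ hEi, A_mul, map_pow]
  exact hmem.pow_right _

/-- The group is a regular branch group over its second derived subgroup. -/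
theorem commutator_commutator_le_ristSub_top (hE : ∑ x, E x = 0) (x : ZMod p) :
    ⁅commutator G, commutator G⁆ ≤ D.ristSub ⊤ x := by
  obtain ⟨i, j, hij, hi, hj, hEi, hEj⟩ := D.exists_two_E_ne_zero hE
  -- The two supports meet only in `-1`, so commutators act only below `-1`; conjugation by a power
  -- of `a` moves them to `x`.
  refine (Subgroup.commutator_mono (D.commutator_le_twoPoint hi hEi)
    (D.commutator_le_twoPoint hj hEj)).trans ?_
  rw [Subgroup.commutator_le]
  intro g hg k hk
  obtain ⟨g', hg0, rfl, hg1⟩ := D.mem_twoPoint.1 hg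
  obtain ⟨k', hk0, rfl, hk1⟩ := D.mem_twoPoint.1 hk
  have hs : ∀ y, D.sec (D.A (x + 1) * ⁅g', k'⁆ * (D.A (x + 1))⁻¹) y =
      ⁅D.sec g' (y - (x + 1)), D.sec k' (y - (x + 1))⁆ := fun y => by
    have := D.sec_conj (D.A (x + 1)) ⁅g', k'⁆ (y - (x + 1))
    rw [act_A, sec_A, sec_A, sub_add_cancel, D.sec_commutator hg0 hk0] at this
    simpa using this
  refine D.mem_ristSub.2 ⟨D.A (x + 1) * ⁅g', k'⁆ * (D.A (x + 1))⁻¹, trivial,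
    by rw [act_conj, act_commutator], ?_, fun y hy => ?_⟩
  · rw [hs]
    congr 2 <;> ring
  · rw [hs]
    have hy1 : y - (x + 1) ≠ -1 := fun h => hy (by
      rw [sub_eq_iff_eq_add] at h
      rw [h]; ring)
    by_cases h : y - (x + 1) = -2 - i
    · rw [hk1 _ hy1 fun h' => hij (sub_right_injective (h.symm.trans h')), commutatorElement_one_right]
    · rw [hg1 _ hy1 h, commutatorElement_one_left]

theorem group_fg (D : GGSData p E G) : Group.FG G :=
  Group.fg_iff.2 ⟨{D.a, D.b}, D.closure_eq_top, by simp⟩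

theorem finiteIndex_ristSub (ht : IsMulTorsion G) {R : Subgroup G} (hR : R.FiniteIndex)
    (x : ZMod p) : (D.ristSub R x).FiniteIndex := by
  have hE := D.sum_E_eq_zero ht
  have hfg := D.group_fg
  have h1 : (commutator G).FiniteIndex := finiteIndex_commutator ht hfg inferInstance
  have h2 : (D.ristSub ⊤ x).FiniteIndex := by
    have := finiteIndex_commutator ht hfg h1
    exact Subgroup.finiteIndex_of_le (D.commutator_commutator_le_ristSub_top hE x)
  refine ⟨?_⟩
  have hle : D.ristSub R x ≤ D.ristSub ⊤ x :=
    Subgroup.map_mono (Subgroup.comap_mono (inf_le_inf_right _ le_top))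
  rw [← Subgroup.relIndex_mul_index hle]
  refine mul_ne_zero (D.relIndex_secSub_ne_zero ?_ x) h2.1
  rw [top_inf_eq, Subgroup.inf_relIndex_right]
  exact (Subgroup.isFiniteRelIndex_of_finiteIndex).relIndex_ne_zero

/-! ### Iterated sections of normal subgroups -/

/-- The iterated section along the letter `0`. -/
def iterSec : ℕ → Subgroup G → Subgroup G
  | 0, H => H
  | n + 1, H => iterSec n (D.secSub H 0)

theorem iterSec_add (m n : ℕ) (H : Subgroup G) :
    D.iterSec n (D.iterSec m H) = D.iterSec (m + n) H := by
  induction m generalizing H with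
  | zero => rw [zero_add]; rfl
  | succ m ih =>
    rw [Nat.succ_add]
    exact ih _

theorem iterSec_succ (n : ℕ) (H : Subgroup G) :
    D.iterSec (n + 1) H = D.secSub (D.iterSec n H) 0 := (D.iterSec_add n 1 H).symm

theorem finiteIndex_iterSec {H : Subgroup G} (hH : H.FiniteIndex) (n : ℕ) :
    (D.iterSec n H).FiniteIndex ∧ (D.iterSec n H).index ≤ H.index := by
  induction n with
  | zero => exact ⟨hH, le_rfl⟩
  | succ n ih =>
    rw [iterSec_succ]
    exact ⟨D.finiteIndex_secSub ih.1 0, (D.index_secSub_le ih.1 0).trans ih.2⟩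

/-- All iterated sections act transitively on the first level. -/
def LevelTransitive (H : Subgroup G) : Prop := ∀ n, ¬ D.iterSec n H ≤ D.St

/-- The index never grows under sections and drops strictly whenever the subgroup fixes the first
level. -/
theorem exists_levelTransitive_iterSec {H : Subgroup G} (hH : H.FiniteIndex) :
    ∃ n, D.LevelTransitive (D.iterSec n H) := by
  induction hd : H.index using Nat.strong_induction_on generalizing H with
  | _ d ih =>
    by_cases ht : D.LevelTransitive H
    · exact ⟨0, ht⟩
    · unfold LevelTransitive at ht
      push Not at ht
      obtain ⟨m, hm⟩ := ht
      obtain ⟨h1, h2⟩ := D.finiteIndex_iterSec hH m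
      have h3 := D.index_secSub_lt h1 hm 0
      rw [← iterSec_succ] at h3
      obtain ⟨n, hn⟩ := ih _ (hd ▸ h3.trans_le h2) (D.finiteIndex_iterSec hH (m + 1)).1 rfl
      exact ⟨m + 1 + n, by rwa [← iterSec_add]⟩

/-! ### Subgroups normalised by a subgroup of finite index -/

/-- Down to finitely many levels, the sections of `N` are trivial or the rigid sections of `R` have
finite index. -/
inductive Dichotomous : Subgroup G → Subgroup G → Prop
  | of_finiteIndex (N R : Subgroup G) (h : R.FiniteIndex) : Dichotomous N R
  | bot (R : Subgroup G) : Dichotomous ⊥ R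
  | of_sections (N R : Subgroup G) (h : ∀ x, Dichotomous (D.secSub N x) (D.ristSub R x)) :
      Dichotomous N R

theorem lift_ristSub_le (R : Subgroup G) : (D.lift fun x => D.ristSub R x) ≤ R := by
  intro g hg
  obtain ⟨h0, h1⟩ := D.mem_lift.1 hg
  have key : ∀ s : Finset (ZMod p), ∃ h ∈ R, D.act h = 0 ∧ (∀ x ∈ s, D.sec h x = D.sec g x) ∧
      ∀ x ∉ s, D.sec h x = 1 := by
    intro s
    induction s using Finset.induction_on with
    | empty => exact ⟨1, one_mem _, D.act_one, by simp, fun x _ => D.sec_one x⟩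
    | insert x s hx ih =>
      obtain ⟨h, hR, hh0, hin, hout⟩ := ih
      obtain ⟨k, hkR, hk0, hkx, hk⟩ := D.mem_ristSub.1 (h1 x)
      refine ⟨h * k, mul_mem hR hkR, by rw [act_mul, hh0, hk0, add_zero], fun y hy => ?_,
        fun y hy => ?_⟩
      · rw [sec_mul, hk0, add_zero]
        by_cases hyx : y = x
        · rw [hyx, hout x hx, hkx, one_mul]
        · rw [hk y hyx, mul_one, hin y ((Finset.mem_insert.1 hy).resolve_left hyx)]
      · rw [Finset.mem_insert, not_or] at hy
        rw [sec_mul, hk0, add_zero, hk y hy.1, mul_one, hout y hy.2]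
  obtain ⟨h, hR, hh0, hin, -⟩ := key Finset.univ
  rwa [← D.eq_of_sec (hh0.trans h0.symm) fun x => hin x (Finset.mem_univ x)]

variable {D}

/-- `F` is assembled from the leaves: `R` where it has finite index, the trivial group where `N` is
trivial. For `N = R` this yields separability of `N`. -/
theorem Dichotomous.exists_separable {N R : Subgroup G} (h : D.Dichotomous N R) :
    ∃ A F : Subgroup G, A.FiniteIndex ∧ F ≤ R ∧ Separable F ∧ F.relIndex (N ⊓ A) ≠ 0 := by
  induction h with
  | of_finiteIndex N R h =>
    exact ⟨⊤, R, inferInstance, le_rfl, Separable.of_finiteIndex h,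
      (Subgroup.isFiniteRelIndex_of_finiteIndex).relIndex_ne_zero⟩
  | bot R =>
    refine ⟨⊤, ⊥, inferInstance, bot_le, D.separable_bot, ?_⟩
    simp
  | of_sections N R _ ih =>
    choose A F hA hF hs hr using ih
    refine ⟨D.lift A, D.lift F, D.finiteIndex_lift hA, ?_, D.separable_lift hs, fun h0 => ?_⟩
    · refine le_trans ?_ (D.lift_ristSub_le R)
      intro g hg
      obtain ⟨hg0, hg1⟩ := D.mem_lift.1 hg
      exact D.mem_lift.2 ⟨hg0, fun x => hF x (hg1 x)⟩
    · refine D.relIndex_lift_ne_zero hr (Subgroup.relIndex_eq_zero_of_le_right ?_ h0)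
      rintro g ⟨hgN, hgA⟩
      obtain ⟨hg0, hg1⟩ := D.mem_lift.1 hgA
      exact D.mem_lift.2 ⟨hg0, fun x => ⟨D.sec_mem_secSub hgN hg0 x, hg1 x⟩⟩

/-- `Δ` normalises `N` and `R`, and double commutators of elements of `N` with elements of `P` lie
in `R`. -/
structure Normalising (N R Δ P : Subgroup G) : Prop where
  finiteIndex : P.FiniteIndex
  conj_left : ∀ d ∈ Δ, ∀ g ∈ N, d * g * d⁻¹ ∈ N
  conj_right : ∀ d ∈ Δ, ∀ g ∈ R, d * g * d⁻¹ ∈ R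
  commutator_mem : ∀ g ∈ N, ∀ r ∈ P, ∀ s ∈ P, ⁅⁅r, g⁆, s⁆ ∈ R

/-- Taking `s` in the rigid stabiliser confines the double commutator to `x`, so it lands in the
rigid section of `R` although `g` is arbitrary elsewhere. -/
theorem Normalising.sections (ht : IsMulTorsion G) {N R Δ P : Subgroup G}
    (h : Normalising N R Δ P) (x : ZMod p) :
    Normalising (D.secSub N x) (D.ristSub R x) (D.secSub Δ x) (D.ristSub P x) where
  finiteIndex := D.finiteIndex_ristSub ht h.finiteIndex x
  conj_left d hd g hg := by
    obtain ⟨d, hdΔ, hd0, rfl⟩ := D.mem_secSub.1 hd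
    obtain ⟨g, hgN, hg0, rfl⟩ := D.mem_secSub.1 hg
    refine D.mem_secSub.2 ⟨_, h.conj_left d hdΔ g hgN, by rw [act_conj, hg0], ?_⟩
    have := D.sec_conj d g x
    rwa [hd0, hg0, add_zero] at this
  conj_right d hd g hg := by
    obtain ⟨d, hdΔ, hd0, rfl⟩ := D.mem_secSub.1 hd
    obtain ⟨g, hgR, hg0, rfl, hgy⟩ := D.mem_ristSub.1 hg
    have hs : ∀ y, D.sec (d * g * d⁻¹) y = D.sec d y * D.sec g y * (D.sec d y)⁻¹ := fun y => by
      have := D.sec_conj d g y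
      rwa [hd0, hg0, add_zero] at this
    refine D.mem_ristSub.2 ⟨_, h.conj_right d hdΔ g hgR, by rw [act_conj, hg0], hs x,
      fun y hy => ?_⟩
    rw [hs, hgy y hy]
    group
  commutator_mem g hg r hr s hs := by
    obtain ⟨g, hgN, hg0, rfl⟩ := D.mem_secSub.1 hg
    obtain ⟨r, hrP, hr0, rfl, hry⟩ := D.mem_ristSub.1 hr
    obtain ⟨s, hsP, hs0, rfl, hsy⟩ := D.mem_ristSub.1 hs
    have hsec : ∀ y, D.sec ⁅⁅r, g⁆, s⁆ y = ⁅⁅D.sec r y, D.sec g y⁆, D.sec s y⁆ := fun y => by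
      rw [D.sec_commutator (D.act_commutator r g) hs0, D.sec_commutator hr0 hg0]
    refine D.mem_ristSub.2 ⟨_, h.commutator_mem g hgN r hrP s hsP, D.act_commutator _ _, hsec x,
      fun y hy => ?_⟩
    rw [hsec, hsy y hy, commutatorElement_one_right]

theorem finiteIndex_conj {g : G} {H : Subgroup G} (hH : H.FiniteIndex) : (conj g H).FiniteIndex :=
  ⟨by
    rw [conj, Subgroup.index_map_of_bijective (MulAut.conj g).bijective]
    exact hH.1⟩

/-- `Δ` conjugates the rigid section at `x` into those at all other letters, and `R` contains their
product. -/
theorem finiteIndex_of_ristSub {R Δ : Subgroup G} (hR : ∀ d ∈ Δ, ∀ g ∈ R, d * g * d⁻¹ ∈ R)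
    (hΔ : ¬ Δ ≤ D.St) {x : ZMod p} (hx : (D.ristSub R x).FiniteIndex) : R.FiniteIndex := by
  obtain ⟨d, hd, hd0⟩ := SetLike.not_le_iff_exists.1 hΔ
  have key : ∀ y, (D.ristSub R y).FiniteIndex := by
    intro y
    obtain ⟨k, hk, hky⟩ := D.exists_mem_act_eq hd hd0 (y - x)
    have := finiteIndex_conj (g := D.sec k x) hx
    refine Subgroup.finiteIndex_of_le (H := conj (D.sec k x) (D.ristSub R x)) ?_
    rintro _ ⟨g, hg, rfl⟩
    obtain ⟨g, hgR, hg0, rfl, hgz⟩ := D.mem_ristSub.1 hg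
    have hs : ∀ z, D.sec (k * g * k⁻¹) (z + (y - x)) = D.sec k z * D.sec g z * (D.sec k z)⁻¹ :=
      fun z => by
        have := D.sec_conj k g z
        rwa [hky, hg0, add_zero] at this
    refine D.mem_ristSub.2 ⟨_, hR k hk g hgR, by rw [act_conj, hg0], ?_, fun z hz => ?_⟩
    · have := hs x
      rwa [add_sub_cancel] at this
    · have := hs (z - (y - x))
      rw [sub_add_cancel] at this
      rw [this, hgz _ fun h => hz (by rw [sub_eq_iff_eq_add] at h; rw [h]; ring)]
      group
  have := D.finiteIndex_lift key
  exact Subgroup.finiteIndex_of_le (D.lift_ristSub_le R)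

/-- For `r` supported below `0`, its conjugate by `g` is supported elsewhere, so `⁅⁅r, g⁆, s⁆`
agrees with `⁅r, s⁆` below `0`. The rigid section of `R` therefore contains a derived subgroup of
finite index. -/
theorem Normalising.finiteIndex_of_act_ne_zero (ht : IsMulTorsion G) {N R Δ P : Subgroup G}
    (h : Normalising N R Δ P) (hΔ : ¬ Δ ≤ D.St) {g : G} (hg : g ∈ N) (hg0 : D.act g ≠ 0) :
    R.FiniteIndex := by
  refine finiteIndex_of_ristSub h.conj_right hΔ (x := 0) ?_
  have h1 := finiteIndex_commutator ht D.group_fg (D.finiteIndex_ristSub ht h.finiteIndex 0)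
  refine Subgroup.finiteIndex_of_le (Subgroup.commutator_le.2 fun r hr s hs => ?_)
    (H := ⁅D.ristSub P 0, D.ristSub P 0⁆)
  obtain ⟨r, hrP, hr0, rfl, hry⟩ := D.mem_ristSub.1 hr
  obtain ⟨s, hsP, hs0, rfl, hsy⟩ := D.mem_ristSub.1 hs
  have hr1 : D.sec ⁅r, g⁆ 0 = D.sec r 0 := by
    have e : ⁅r, g⁆ = r * (g * r⁻¹ * g⁻¹) := by rw [commutatorElement_def]; group
    have h2 := D.sec_conj g r⁻¹ (-D.act g)
    rw [neg_add_cancel, act_inv, hr0, neg_zero, add_zero, sec_inv, hr0, sub_zero,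
      hry _ (neg_ne_zero.2 hg0)] at h2
    rw [e, sec_mul, act_conj, act_inv, hr0, neg_zero, add_zero, h2]
    group
  refine D.mem_ristSub.2 ⟨_, h.commutator_mem g hg r hrP s hsP, D.act_commutator _ _, ?_,
    fun y hy => ?_⟩
  · rw [D.sec_commutator (D.act_commutator r g) hs0, hr1]
  · rw [D.sec_commutator (D.act_commutator r g) hs0, hsy y hy, commutatorElement_one_right]

/-- Descend along `w` until `g` moves a letter, then climb back, using at each level that the
section of `Δ` is transitive. -/
theorem Normalising.finiteIndex_of_levelTransitive (ht : IsMulTorsion G) {N R Δ P : Subgroup G}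
    (h : Normalising N R Δ P) (hn : Δ.Normal) (hΔ : D.LevelTransitive Δ) {g : G} (hg : g ∈ N)
    {w : List (ZMod p)} (hw : D.act (w.foldl D.sec g) ≠ 0) : R.FiniteIndex := by
  induction w generalizing N R Δ P g with
  | nil => exact h.finiteIndex_of_act_ne_zero ht (hΔ 0) hg hw
  | cons x w ih =>
    by_cases hg0 : D.act g = 0
    · refine finiteIndex_of_ristSub h.conj_right (hΔ 0) (x := x) ?_
      refine ih (h.sections ht x) (D.secSub_normal hn x) ?_ (D.sec_mem_secSub hg hg0 x) hw
      rw [D.secSub_eq_of_normal hn]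
      exact fun n => hΔ (n + 1)
    · exact h.finiteIndex_of_act_ne_zero ht (hΔ 0) hg hg0

theorem Normalising.dichotomous (ht : IsMulTorsion G) {N R Δ P : Subgroup G}
    (h : Normalising N R Δ P) (hn : Δ.Normal) {n : ℕ} (hΔ : D.LevelTransitive (D.iterSec n Δ)) :
    D.Dichotomous N R := by
  induction n generalizing N R Δ P with
  | zero =>
    by_cases hN : N = ⊥
    · rw [hN]
      exact Dichotomous.bot R
    · obtain ⟨⟨g, hg⟩, hg1⟩ := Subgroup.ne_bot_iff_exists_ne_one.1 hN
      obtain ⟨w, hw⟩ := D.exists_act_foldl_ne_zero (g := g) fun h => hg1 (Subtype.ext h)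
      exact Dichotomous.of_finiteIndex _ _ (h.finiteIndex_of_levelTransitive ht hn hΔ hg hw)
  | succ n ih =>
    refine Dichotomous.of_sections _ _ fun x => ih (h.sections ht x) (D.secSub_normal hn x) ?_
    rw [D.secSub_eq_of_normal hn]
    exact hΔ

/-- In a torsion group, every subgroup normalised by a subgroup of finite index is separable. -/
theorem normalSeparable (D : GGSData p E G) (ht : IsMulTorsion G) : NormalSeparable G := by
  intro A N hA hN
  have hΔ : A.normalCore.FiniteIndex := inferInstance
  have h : Normalising N N A.normalCore A.normalCore := by
    have hc : ∀ d ∈ A.normalCore, ∀ g ∈ N, d * g * d⁻¹ ∈ N :=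
      fun d hd => hN d (A.normalCore_le hd)
    refine ⟨hΔ, hc, hc, fun g hg r hr s hs => ?_⟩
    have h1 : ⁅r, g⁆ ∈ N := mul_mem (hc r hr g hg) (inv_mem hg)
    have h2 : ⁅⁅r, g⁆, s⁆ = ⁅r, g⁆ * (s * ⁅r, g⁆⁻¹ * s⁻¹) := by
      rw [commutatorElement_def ⁅r, g⁆ s]; group
    rw [h2]
    exact mul_mem h1 (hc s hs _ (inv_mem h1))
  obtain ⟨n, hn⟩ := D.exists_levelTransitive_iterSec hΔ
  obtain ⟨B, F, hB, hFN, hF, hrel⟩ := (h.dichotomous ht inferInstance hn).exists_separable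
  refine hF.of_relIndex hFN (Subgroup.relIndex_ne_zero_trans hrel ?_)
  rw [Subgroup.inf_relIndex_left]
  exact (Subgroup.isFiniteRelIndex_of_finiteIndex).relIndex_ne_zero

/-! ### Tame subgroups are separable -/

/-- The group is virtually a subgroup of a power of itself, in such a way that the projections of
`H` to the factors are finite or of finite index. -/
def HasCoordinates (H : Subgroup G) : Prop :=
  ∃ (ι : Type) (_ : Finite ι) (A : Subgroup G) (f : A →* (ι → G)), A.FiniteIndex ∧
    Function.Injective f ∧
    ∀ i, FiniteOrCofinite ((H.subgroupOf A).map ((Pi.evalMonoidHom (fun _ : ι => G) i).comp f))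

theorem HasCoordinates.separable {H : Subgroup G} (h : HasCoordinates H)
    (hG : NormalSeparable G) : Separable H := by
  obtain ⟨ι, hι, A, f, hA, hf, hH⟩ := h
  have h1 : Separable ((H.subgroupOf A).map f) :=
    hG.separable_pi _ fun i => by rw [Subgroup.map_map]; exact hH i
  have h2 := h1.comap f
  rw [Subgroup.comap_map_eq_self_of_injective hf] at h2
  have h3 := h2.map_subtype hA
  rw [Subgroup.subgroupOf_map_subtype] at h3
  refine h3.of_relIndex inf_le_left ?_
  rw [Subgroup.inf_relIndex_left]
  exact (Subgroup.isFiniteRelIndex_of_finiteIndex).relIndex_ne_zero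

theorem HasCoordinates.of_finiteOrCofinite {H : Subgroup G} (h : FiniteOrCofinite H) :
    HasCoordinates H := by
  refine ⟨Unit, inferInstance, ⊤, MonoidHom.pi fun _ => Subgroup.subtype ⊤, inferInstance, ?_, ?_⟩
  · intro g k hgk
    exact Subtype.ext (congrFun hgk ())
  · intro i
    have : (H.subgroupOf ⊤).map ((Pi.evalMonoidHom (fun _ : Unit => G) i).comp
        (MonoidHom.pi fun _ => Subgroup.subtype ⊤)) = H := by
      have h1 : (Pi.evalMonoidHom (fun _ : Unit => G) i).comp
        (MonoidHom.pi fun _ => Subgroup.subtype ⊤) = Subgroup.subtype (⊤ : Subgroup G) := rfl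
      rw [h1, Subgroup.subgroupOf_map_subtype, inf_top_eq]
    rwa [this]

/-- The coordinates of an element fixing the first level are those of its sections. Restricting `H`
to the common domain changes each projection only by finite index. -/
theorem Tame.hasCoordinates {H : Subgroup G} (hH : D.Tame H) : HasCoordinates H := by
  induction hH with
  | top => exact HasCoordinates.of_finiteOrCofinite (Or.inr inferInstance)
  | of_finite H h => exact HasCoordinates.of_finiteOrCofinite (Or.inl h)
  | of_sections H _ ih =>
    choose ι hι A f hA hf hH using ih
    have hmem : ∀ x, ∀ g : D.lift A, D.sec (g : G) x ∈ A x := fun x g => (D.mem_lift.1 g.2).2 x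
    have hact : ∀ g : D.lift A, D.act (g : G) = 0 := fun g => (D.mem_lift.1 g.2).1
    let s : ∀ x, D.lift A →* A x := fun x =>
      { toFun := fun g => ⟨D.sec g x, hmem x g⟩
        map_one' := Subtype.ext (D.sec_one x)
        map_mul' := fun g k => Subtype.ext <| by
          change D.sec ((g : G) * k) x = D.sec g x * D.sec k x
          rw [sec_mul, hact, add_zero] }
    refine ⟨Σ x, ι x, inferInstance, D.lift A,
      MonoidHom.pi fun i => ((Pi.evalMonoidHom _ i.2).comp (f i.1)).comp (s i.1),
      D.finiteIndex_lift hA, ?_, ?_⟩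
    · intro g k hgk
      refine Subtype.ext (D.eq_of_sec ((hact g).trans (hact k).symm) fun x => ?_)
      have : s x g = s x k := hf x (funext fun i => congrFun hgk ⟨x, i⟩)
      exact congrArg Subtype.val this
    · rintro ⟨x, i⟩
      have h1 : (H.subgroupOf (D.lift A)).map
          ((Pi.evalMonoidHom (fun _ : (Σ x, ι x) => G) ⟨x, i⟩).comp
            (MonoidHom.pi fun i => ((Pi.evalMonoidHom _ i.2).comp (f i.1)).comp (s i.1))) =
          ((H.subgroupOf (D.lift A)).map (s x)).map ((Pi.evalMonoidHom _ i).comp (f x)) := by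
        rw [Subgroup.map_map]
        rfl
      rw [h1]
      have hle : (H.subgroupOf (D.lift A)).map (s x) ≤ (D.secSub H x).subgroupOf (A x) := by
        rintro _ ⟨g, hg, rfl⟩
        exact D.sec_mem_secSub hg (hact g) x
      refine (hH x i).of_relIndex (Subgroup.map_mono hle) (relIndex_map_ne_zero _ ?_)
      rw [← Subgroup.relIndex_map_map_of_injective _ _ (A x).subtype_injective,
        Subgroup.subgroupOf_map_subtype]
      have h2 : D.secSub (H ⊓ D.lift A) x ≤
          ((H.subgroupOf (D.lift A)).map (s x)).map (A x).subtype := by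
        intro g hg
        obtain ⟨k, ⟨hkH, hkA⟩, hk0, rfl⟩ := D.mem_secSub.1 hg
        exact ⟨s x ⟨k, hkA⟩, ⟨⟨k, hkA⟩, hkH, rfl⟩, rfl⟩
      have h3 : (D.secSub (H ⊓ D.lift A) x).relIndex (D.secSub H x) ≠ 0 := by
        refine D.relIndex_secSub_ne_zero ?_ x
        rw [Subgroup.inf_relIndex_left]
        have := D.finiteIndex_lift hA
        exact (Subgroup.isFiniteRelIndex_of_finiteIndex).relIndex_ne_zero
      intro h0
      exact h3 (Subgroup.relIndex_eq_zero_of_le_right inf_le_left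
        (Subgroup.relIndex_eq_zero_of_le_left h2 h0))

end GGSData

end GGS

theorem mainTheorem5 (p : ℕ) [Fact p.Prime] (hp : Odd p)
    (e : Fin (p - 1) → ZMod p) (he : e ≠ 0)
    (htors : IsMulTorsion (GGS.ggsGroup e)) :
    GGS.SubgroupSeparable (GGS.ggsGroup e) := by
  intro H hH
  let D := GGS.ggsData he
  have htame : D.Tame H := GGS.GGSData.tame_of_fg (D.sum_E_eq_zero htors) hH
  exact (htame.hasCoordinates.separable (D.normalSeparable htors)).isClosed
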